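/- \textbf{Setting.} A \emph{hypergraph} $H=(V,\mathcal E)$ is finite, has non-empty hyperedges (distinct hyperedges may contain the same vertices) and a connected incidence graph; $m=|\mathcal E|$ and $N=\sum_{E\in\mathcal E}|E|$. A \emph{join tree} of $H$ is a tree $T$ whose nodes are the hyperedges of $H$ such that, for each $v\in V$, the hyperedges containing $v$ induce a subtree of $T$. $H$ is \emph{($\alpha$-)acyclic} if it has a join tree, and a \emph{hypertree} if there is a tree on $V$ in which every hyperedge induces a subtree. The \emph{union join graph} of an acyclic hypergraph $H$ is the graph on $\mathcal E$ in which two hyperedges are adjacent if and only if they are adjacent in some join tree of $H$. Algorithms are deterministic word RAM programs. A hypergraph is given by its incidence graph (each hyperedge as the list of its vertices), with words of $O(\log N)$ bits; a graph is output as a list of its edges. The \emph{Strong Exponential Time Hypothesis} (SETH) states that there are no $\delta>0$ and no algorithm that decides the satisfiability of CNF formulas with $n$ variables (without limitation on clause size) in $O\bigl((2-\delta)^n\bigr)$ time, up to a factor polynomial in the size of the formula, with words whose length is linear in $n$ plus the logarithm of the size of the formula. \textbf{Theorem.} Assume SETH. Then, for every $\varepsilon>0$, no algorithm constructs the union join graph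 of a given acyclic hypergraph in $O(N^{2-\varepsilon})$ time, even if that graph is sparse. Precisely: let $\varepsilon>0$ and $K\ge 1$. There is no algorithm such that, for every acyclic hypergraph $H$, \begin{enumerate} \item if the algorithm halts on $H$, then its output is the union join graph of $H$, and \item if the union join graph of $H$ has at most $K\cdot m$ edges, then the algorithm halts on $H$ within $O(N^{2-\varepsilon})$ time. \end{enumerate} The same holds if only hypergraphs $H$ that are both acyclic and hypertrees are considered. -/

import Mathlib

/-! ### Word RAM

A word RAM has registers and a random-access memory, all holding natural numbers (words).  A program
names finitely many registers; memory is addressed indirectly.  Control flow is structured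
(sequence, branch, loop).  Every elementary instruction and every test takes one time unit. -/

namespace RAM

/-- Binary word operations (`sub` is truncated, `div` rounds down). -/
inductive Op where
  | add | sub | mul | div | mod | land | lor | xor

/-- The meaning of a word operation. -/
def Op.eval : Op → ℕ → ℕ → ℕ
  | .add, x, y => x + y
  | .sub, x, y => x - y
  | .mul, x, y => x * y
  | .div, x, y => x / y
  | .mod, x, y => x % y
  | .land, x, y => x &&& y
  | .lor, x, y => x ||| y
  | .xor, x, y => x ^^^ y

/-- Programs; `a`, `b`, `d` are register numbers. -/
inductive Prog where
  /-- do nothing -/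
  | skip
  /-- `r_d := k` -/
  | const (d k : ℕ)
  /-- `r_d := r_a ∘ r_b` -/
  | op (o : Op) (d a b : ℕ)
  /-- `r_d := mem[r_a]` -/
  | load (d a : ℕ)
  /-- `mem[r_a] := r_b` -/
  | store (a b : ℕ)
  /-- first `p`, then `q` -/
  | seq (p q : Prog)
  /-- if `r_a ≠ 0` then `p` else `q` -/
  | ite (a : ℕ) (p q : Prog)
  /-- while `r_a ≠ 0` do `p` -/
  | loop (a : ℕ) (p : Prog)

/-- A machine state. -/
structure State where
  /-- contents of the registers -/
  reg : ℕ → ℕ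
  /-- contents of the memory -/
  mem : ℕ → ℕ

/-- Write `x` into register `d`. -/
def State.setReg (s : State) (d x : ℕ) : State := { s with reg := Function.update s.reg d x }

/-- Write `x` into memory cell `i`. -/
def State.setMem (s : State) (i x : ℕ) : State := { s with mem := Function.update s.mem i x }

/-- `Exec W p s t s'`: on words of values at most `W`, the program `p` started in `s` halts in `s'`
after exactly `t` time units.  A run that would write a value larger than `W` has no result, and
neither does a run that does not halt. -/
inductive Exec (W : ℕ) : Prog → State → ℕ → State → Prop
  | skip (s : State) : Exec W .skip s 1 s
  | const (s : State) (d k : ℕ) (h : k ≤ W) : Exec W (.const d k) s 1 (s.setReg d k)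
  | op (s : State) (o : Op) (d a b : ℕ) (h : o.eval (s.reg a) (s.reg b) ≤ W) :
      Exec W (.op o d a b) s 1 (s.setReg d (o.eval (s.reg a) (s.reg b)))
  | load (s : State) (d a : ℕ) (h : s.mem (s.reg a) ≤ W) :
      Exec W (.load d a) s 1 (s.setReg d (s.mem (s.reg a)))
  | store (s : State) (a b : ℕ) (h : s.reg b ≤ W) :
      Exec W (.store a b) s 1 (s.setMem (s.reg a) (s.reg b))
  | seq (p q : Prog) (s s' s'' : State) (t t' : ℕ) (h : Exec W p s t s')
      (h' : Exec W q s' t' s'') : Exec W (.seq p q) s (t + t') s''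
  | ite_true (a : ℕ) (p q : Prog) (s s' : State) (t : ℕ) (ha : s.reg a ≠ 0)
      (h : Exec W p s t s') : Exec W (.ite a p q) s (t + 1) s'
  | ite_false (a : ℕ) (p q : Prog) (s s' : State) (t : ℕ) (ha : s.reg a = 0)
      (h : Exec W q s t s') : Exec W (.ite a p q) s (t + 1) s'
  | loop_done (a : ℕ) (p : Prog) (s : State) (ha : s.reg a = 0) : Exec W (.loop a p) s 1 s
  | loop_step (a : ℕ) (p : Prog) (s s' s'' : State) (t t' : ℕ) (ha : s.reg a ≠ 0)
      (h : Exec W p s t s') (h' : Exec W (.loop a p) s' t' s'') :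
      Exec W (.loop a p) s (t + t' + 1) s''

/-- The initial state: the input stands in memory from cell `0` on, its length in register `0`,
and everything else is `0`. -/
def State.initial (input : List ℕ) : State where
  reg := fun i => if i = 0 then input.length else 0
  mem := fun i => input.getD i 0

/-- The output of a halted machine: register `0` holds its length, and it stands in memory from
cell `0` on. -/
def State.output (s : State) : List ℕ := (List.range (s.reg 0)).map s.mem

end RAM

/-! ### Satisfiability and SETH -/

/-- A formula in conjunctive normal form over `numVars` variables, without limitation on the number
or the size of its clauses.  The literal `(x, true)` is `x` and `(x, false)` is `¬ x`. -/
structure CNFFormula where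
  /-- number of variables -/
  numVars : ℕ
  /-- the clauses, each a list of literals -/
  clauses : List (List (Fin numVars × Bool))

namespace CNFFormula

/-- The formula has a satisfying assignment. -/
def Satisfiable (φ : CNFFormula) : Prop :=
  ∃ σ : Fin φ.numVars → Bool, ∀ c ∈ φ.clauses, ∃ l ∈ c, σ l.1 = l.2

/-- The size of a formula (a positive number). -/
def size (φ : CNFFormula) : ℕ := 1 + φ.numVars + (φ.clauses.map fun c => c.length + 1).sum

/-- Input format: number of variables, number of clauses, then for each clause its length followed
by its literals, where `x_i` is written `2 i + 1` and `¬ x_i` is written `2 i`. -/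
def encode (φ : CNFFormula) : List ℕ :=
  φ.numVars :: φ.clauses.length ::
    φ.clauses.flatMap fun c => c.length :: c.map fun l => 2 * (l.1 : ℕ) + l.2.toNat

end CNFFormula

open Classical in
/-- `p` decides satisfiability of CNF formulas in time `O((2 - δ) ^ n)`, up to a factor polynomial
in the size of the formula, on words of `O(n + log size)` bits. -/
def SolvesSATInTime (p : RAM.Prog) (δ : ℝ) : Prop :=
  ∃ C k : ℕ, ∀ φ : CNFFormula, ∃ (t : ℕ) (s : RAM.State),
    RAM.Exec (C * (2 ^ φ.numVars * φ.size) ^ k) p (RAM.State.initial φ.encode) t s ∧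
    (t : ℝ) ≤ C * (2 - δ) ^ φ.numVars * (φ.size : ℝ) ^ k ∧
    s.output = [if φ.Satisfiable then 1 else 0]

/-- The Strong Exponential Time Hypothesis. -/
def SETH : Prop := ¬ ∃ (δ : ℝ) (p : RAM.Prog), 0 < δ ∧ δ < 1 ∧ SolvesSATInTime p δ

/-! ### Hypergraphs and join trees -/

/-- A finite hypergraph with non-empty hyperedges.  Hyperedges are indexed, so distinct hyperedges
may contain the same vertices. -/
structure FinHypergraph where
  /-- number of vertices -/
  n : ℕ
  /-- number of hyperedges -/
  m : ℕ
  /-- the hyperedges -/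
  edge : Fin m → Finset (Fin n)
  /-- every hyperedge contains a vertex -/
  edge_nonempty : ∀ i, (edge i).Nonempty

namespace FinHypergraph

/-- The total size `N` of all hyperedges. -/
def totalSize (H : FinHypergraph) : ℕ := ∑ i, (H.edge i).card

/-- The incidence graph. -/
def incidenceGraph (H : FinHypergraph) : SimpleGraph (Fin H.n ⊕ Fin H.m) :=
  SimpleGraph.fromRel fun x y => ∃ v i, x = .inl v ∧ y = .inr i ∧ v ∈ H.edge i

/-- A join tree: a tree on the hyperedges in which, for each vertex `v`, the hyperedges that
contain `v` induce a subtree. -/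
def IsJoinTree (H : FinHypergraph) (T : SimpleGraph (Fin H.m)) : Prop :=
  T.IsTree ∧ ∀ v : Fin H.n, (T.induce {i | v ∈ H.edge i}).Preconnected

/-- `α`-acyclic: there is a join tree. -/
def IsAcyclic (H : FinHypergraph) : Prop := ∃ T, H.IsJoinTree T

/-- A hypertree: there is a tree on the vertices in which each hyperedge induces a subtree. -/
def IsHypertree (H : FinHypergraph) : Prop :=
  ∃ T : SimpleGraph (Fin H.n), T.IsTree ∧
    ∀ i, (T.induce (H.edge i : Set (Fin H.n))).Preconnected

/-- The union join graph: the union of all join trees. -/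
def unionJoinGraph (H : FinHypergraph) : SimpleGraph (Fin H.m) where
  Adj i j := ∃ T, H.IsJoinTree T ∧ T.Adj i j
  symm := ⟨fun _ _ ⟨T, hT, h⟩ => ⟨T, hT, h.symm⟩⟩
  loopless := ⟨fun _ ⟨_, _, h⟩ => h.ne rfl⟩

/-- Input format (the incidence graph): `n`, `m`, then for each hyperedge its cardinality followed
by its vertices in increasing order. -/
def encode (H : FinHypergraph) : List ℕ :=
  H.n :: H.m :: (List.finRange H.m).flatMap fun i =>
    (H.edge i).card :: ((List.finRange H.n).filter (· ∈ H.edge i)).map Fin.val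

end FinHypergraph

/-- Output format: `l` lists the edges of `G`, each exactly once, an edge `ij` as the two consecutive
entries `i, j` or `j, i`. -/
def IsEdgeList {m : ℕ} (G : SimpleGraph (Fin m)) (l : List ℕ) : Prop :=
  ∃ es : List (Fin m × Fin m),
    l = es.flatMap (fun e => [(e.1 : ℕ), (e.2 : ℕ)]) ∧
    (es.map fun e => s(e.1, e.2)).Nodup ∧
    ∀ e : Sym2 (Fin m), e ∈ es.map (fun e => s(e.1, e.2)) ↔ e ∈ G.edgeSet

/-- A graph on `m` vertices is `K`-sparse if it has at most `K * m` edges. -/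
def IsSparse (K : ℝ) {m : ℕ} (G : SimpleGraph (Fin m)) : Prop :=
  (G.edgeSet.ncard : ℝ) ≤ K * m

/-- `p` constructs the union join graph of a given hypergraph of the class `P` (with connected
incidence graph): on words of `O(log N)` bits, whatever it outputs is the union join graph, and it
halts within `O(N ^ (2 - ε))` time whenever that graph is `K`-sparse.  No running time is asked for
on the other hypergraphs of the class. -/
def ConstructsUnionJoinGraph (P : FinHypergraph → Prop) (K ε : ℝ) (p : RAM.Prog) : Prop :=
  ∃ C k : ℕ, ∀ H : FinHypergraph, H.incidenceGraph.Connected → P H →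
    (∀ (t : ℕ) (s : RAM.State),
      RAM.Exec (C * H.totalSize ^ k) p (RAM.State.initial H.encode) t s →
        IsEdgeList H.unionJoinGraph s.output) ∧
    (IsSparse K H.unionJoinGraph →
      ∃ (t : ℕ) (s : RAM.State),
        RAM.Exec (C * H.totalSize ^ k) p (RAM.State.initial H.encode) t s ∧
        (t : ℝ) ≤ C * (H.totalSize : ℝ) ^ (2 - ε))

/-! ### Weakest preconditions for word RAM programs -/

/-! The proof is a split-and-list reduction from satisfiability. If a hyperedge `c` contains all
vertices, then the star centred at `c` is a join tree. An edge `ij` of a join tree that avoids `c`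
joins comparable hyperedges: deleting it separates `i` from `j`, whereas a vertex of `E_i` outside
`E_j` still links `i` to `c` through hyperedges other than `j`, and likewise with `i` and `j`
exchanged (`IsJoinTree.subset_or_subset`). Conversely, if `E_i ⊆ E_j`, then moving the leaf `i` from
`c` to `j` gives another join tree. Hence the union join graph has exactly `m - 1` edges if the
hyperedges other than `c` are pairwise incomparable, and at least `m` edges otherwise.

A formula with `n` variables yields about `2 ^ (n / 2)` hyperedges, one for each assignment of
either half of the variables, plus the centre. Containments that do not involve the centre
correspond to satisfying assignments (`satisfiable_of_subset`, `Satisfiable.exists_subset`). So the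
number of edges decides satisfiability, and for an unsatisfiable formula the graph is a star, hence
sparse. For a satisfiable formula it may be dense, and then nothing is known about the running time.
The given program is therefore simulated with a clock and a bound on its words; if the simulation
has to be stopped, the formula is satisfiable (`wp_sim`, `wp_solveSat`).

Up to factors polynomial in the size of the formula, `N` is `2 ^ (n / 2)`. With an integer `q ≥ 2 /
ε`, a clock of `C * (N ^ 2 / 2 ^ (n / q) + 1)` time units is long enough for a run of length `C * N
^ (2 - ε)` (`le_timeLimit`) and short enough to contradict SETH with the base `2 ^ (1 - 1 / q)`
(`solveCost_le`, `two_pow_sub_div_le`). Both classes of hypergraphs are treated at once, because a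
vertex common to all hyperedges makes the constructed hypergraph a hypertree.

The rest is a verified implementation: a calculus of weakest preconditions that carries the elapsed
time, a program that writes the hypergraph behind the formula, and the simulator. -/

namespace RAM

infixr:60 ";;" => Prog.seq

/-- `d := a`, realised by a single bitwise instruction. -/
def Prog.copy (d a : ℕ) : Prog := .op .lor d a a

@[simp] theorem State.setReg_reg (s : State) (d x j : ℕ) :
    (s.setReg d x).reg j = if j = d then x else s.reg j := by
  simp [State.setReg, Function.update_apply]

@[simp] theorem State.setReg_mem (s : State) (d x : ℕ) : (s.setReg d x).mem = s.mem := rfl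

@[simp] theorem State.setMem_reg (s : State) (i x : ℕ) : (s.setMem i x).reg = s.reg := rfl

@[simp] theorem State.setMem_mem (s : State) (i x : ℕ) :
    (s.setMem i x).mem = Function.update s.mem i x := rfl

/-- The program `p`, started in `s` at time `t₀`, halts at a time and in a state that
satisfy `Q`. -/
def wp (W : ℕ) (p : Prog) (s : State) (t₀ : ℕ) (Q : ℕ → State → Prop) : Prop :=
  ∃ t s', Exec W p s t s' ∧ Q (t₀ + t) s'

variable {W : ℕ} {s : State} {t₀ : ℕ} {Q : ℕ → State → Prop}

theorem wp_skip : wp W .skip s t₀ Q ↔ Q (t₀ + 1) s := by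
  constructor
  · rintro ⟨t, s', h, hQ⟩
    cases h
    exact hQ
  · exact fun h => ⟨1, s, .skip s, h⟩

theorem wp_const {d k : ℕ} :
    wp W (.const d k) s t₀ Q ↔ k ≤ W ∧ Q (t₀ + 1) (s.setReg d k) := by
  constructor
  · rintro ⟨t, s', h, hQ⟩
    cases h with
    | const _ _ _ h => exact ⟨h, hQ⟩
  · exact fun h => ⟨1, _, .const s d k h.1, h.2⟩

theorem wp_op {o : Op} {d a b : ℕ} :
    wp W (.op o d a b) s t₀ Q ↔ o.eval (s.reg a) (s.reg b) ≤ W ∧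
      Q (t₀ + 1) (s.setReg d (o.eval (s.reg a) (s.reg b))) := by
  constructor
  · rintro ⟨t, s', h, hQ⟩
    cases h with
    | op _ _ _ _ _ h => exact ⟨h, hQ⟩
  · exact fun h => ⟨1, _, .op s o d a b h.1, h.2⟩

theorem wp_copy {d a : ℕ} :
    wp W (.copy d a) s t₀ Q ↔ s.reg a ≤ W ∧ Q (t₀ + 1) (s.setReg d (s.reg a)) := by
  simp [Prog.copy, wp_op, Op.eval]

theorem wp_load {d a : ℕ} :
    wp W (.load d a) s t₀ Q ↔ s.mem (s.reg a) ≤ W ∧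
      Q (t₀ + 1) (s.setReg d (s.mem (s.reg a))) := by
  constructor
  · rintro ⟨t, s', h, hQ⟩
    cases h with
    | load _ _ _ h => exact ⟨h, hQ⟩
  · exact fun h => ⟨1, _, .load s d a h.1, h.2⟩

theorem wp_store {a b : ℕ} :
    wp W (.store a b) s t₀ Q ↔ s.reg b ≤ W ∧ Q (t₀ + 1) (s.setMem (s.reg a) (s.reg b)) := by
  constructor
  · rintro ⟨t, s', h, hQ⟩
    cases h with
    | store _ _ _ h => exact ⟨h, hQ⟩
  · exact fun h => ⟨1, _, .store s a b h.1, h.2⟩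

theorem wp_seq {p q : Prog} :
    wp W (p ;; q) s t₀ Q ↔ wp W p s t₀ fun t s' => wp W q s' t Q := by
  constructor
  · rintro ⟨t, s', h, hQ⟩
    cases h with
    | seq _ _ _ s₁ _ t₁ t₂ h₁ h₂ => exact ⟨t₁, s₁, h₁, t₂, _, h₂, by rwa [Nat.add_assoc]⟩
  · rintro ⟨t₁, s₁, h₁, t₂, s₂, h₂, hQ⟩
    exact ⟨_, _, .seq p q s s₁ s₂ t₁ t₂ h₁ h₂, by rwa [← Nat.add_assoc]⟩

theorem wp_ite {a : ℕ} {p q : Prog} :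
    wp W (.ite a p q) s t₀ Q ↔
      (s.reg a ≠ 0 → wp W p s (t₀ + 1) Q) ∧ (s.reg a = 0 → wp W q s (t₀ + 1) Q) := by
  constructor
  · rintro ⟨t, s', h, hQ⟩
    cases h with
    | ite_true _ _ _ _ _ t ha h =>
      exact ⟨fun _ => ⟨t, _, h, by rwa [Nat.add_assoc, Nat.add_comm 1]⟩, fun h' => absurd h' ha⟩
    | ite_false _ _ _ _ _ t ha h =>
      exact ⟨fun h' => absurd ha h', fun _ => ⟨t, _, h, by rwa [Nat.add_assoc, Nat.add_comm 1]⟩⟩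
  · rintro ⟨h₁, h₂⟩
    by_cases ha : s.reg a = 0
    · obtain ⟨t, s', h, hQ⟩ := h₂ ha
      exact ⟨_, _, .ite_false a p q s s' t ha h, by rwa [Nat.add_comm t, ← Nat.add_assoc]⟩
    · obtain ⟨t, s', h, hQ⟩ := h₁ ha
      exact ⟨_, _, .ite_true a p q s s' t ha h, by rwa [Nat.add_comm t, ← Nat.add_assoc]⟩

theorem wp_loop {a : ℕ} {p : Prog} :
    wp W (.loop a p) s t₀ Q ↔
      (s.reg a ≠ 0 → wp W p s (t₀ + 1) fun t s' => wp W (.loop a p) s' t Q) ∧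
        (s.reg a = 0 → Q (t₀ + 1) s) := by
  constructor
  · rintro ⟨t, s', h, hQ⟩
    cases h with
    | loop_done _ _ _ ha => exact ⟨fun h' => absurd ha h', fun _ => hQ⟩
    | loop_step _ _ _ s₁ _ t₁ t₂ ha h h' =>
      refine ⟨fun _ => ⟨t₁, s₁, h, t₂, _, h', ?_⟩, fun h' => absurd h' ha⟩
      rwa [show t₀ + 1 + t₁ + t₂ = t₀ + (t₁ + t₂ + 1) by omega]
  · rintro ⟨h₁, h₂⟩
    by_cases ha : s.reg a = 0
    · exact ⟨1, s, .loop_done a p s ha, h₂ ha⟩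
    · obtain ⟨t₁, s₁, h, t₂, s₂, h', hQ⟩ := h₁ ha
      refine ⟨_, _, .loop_step a p s s₁ s₂ t₁ t₂ ha h h', ?_⟩
      rwa [show t₀ + (t₁ + t₂ + 1) = t₀ + 1 + t₁ + t₂ by omega]

theorem wp.mono {p : Prog} {Q' : ℕ → State → Prop} (h : wp W p s t₀ Q)
    (hQ : ∀ t s', Q t s' → Q' t s') : wp W p s t₀ Q' := by
  obtain ⟨t, s', he, h⟩ := h
  exact ⟨t, s', he, hQ _ _ h⟩

theorem wp_time {p : Prog} (h : wp W p s 0 fun t => Q (t₀ + t)) : wp W p s t₀ Q := by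
  obtain ⟨t, s', he, h⟩ := h
  exact ⟨t, s', he, by simpa using h⟩

/-- The result of a run is determined by the program and its initial state. -/
theorem Exec.unique {p : Prog} {s₁ s₂ : State} {t₁ t₂ : ℕ} (h₁ : Exec W p s t₁ s₁)
    (h₂ : Exec W p s t₂ s₂) : t₁ = t₂ ∧ s₁ = s₂ := by
  induction h₁ generalizing t₂ s₂ with
  | skip | const | op | load | store => cases h₂; exact ⟨rfl, rfl⟩
  | seq p q s s' s'' t t' _ _ ih ih' =>
    cases h₂ with
    | seq _ _ _ _ _ _ _ g g' =>
      obtain ⟨rfl, rfl⟩ := ih g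
      obtain ⟨rfl, rfl⟩ := ih' g'
      exact ⟨rfl, rfl⟩
  | ite_true a p q s s' t ha _ ih =>
    cases h₂ with
    | ite_true _ _ _ _ _ _ _ g => obtain ⟨rfl, rfl⟩ := ih g; exact ⟨rfl, rfl⟩
    | ite_false _ _ _ _ _ _ ha' g => exact absurd ha' ha
  | ite_false a p q s s' t ha _ ih =>
    cases h₂ with
    | ite_true _ _ _ _ _ _ ha' g => exact absurd ha ha'
    | ite_false _ _ _ _ _ _ _ g => obtain ⟨rfl, rfl⟩ := ih g; exact ⟨rfl, rfl⟩
  | loop_done a p s ha =>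
    cases h₂ with
    | loop_done => exact ⟨rfl, rfl⟩
    | loop_step _ _ _ _ _ _ _ ha' => exact absurd ha ha'
  | loop_step a p s s' s'' t t' ha _ _ ih ih' =>
    cases h₂ with
    | loop_done _ _ _ ha' => exact absurd ha' ha
    | loop_step _ _ _ _ _ _ _ _ g g' =>
      obtain ⟨rfl, rfl⟩ := ih g
      obtain ⟨rfl, rfl⟩ := ih' g'
      exact ⟨rfl, rfl⟩

/-- The program may write the register `r`. -/
def Prog.writes : Prog → ℕ → Bool
  | .skip, _ => false
  | .const d _, r => r == d
  | .op _ d _ _, r => r == d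
  | .load d _, r => r == d
  | .store _ _, _ => false
  | .seq p q, r => p.writes r || q.writes r
  | .ite _ p q, r => p.writes r || q.writes r
  | .loop _ p, r => p.writes r

theorem Exec.reg_eq {p : Prog} {s' : State} {t r : ℕ} (h : Exec W p s t s')
    (hr : p.writes r = false) : s'.reg r = s.reg r := by
  induction h with
  | skip | store | loop_done => rfl
  | const | op | load =>
    simp only [Prog.writes, beq_eq_false_iff_ne] at hr
    simp [hr]
  | seq p q s s' s'' t t' _ _ ih ih' =>
    simp only [Prog.writes, Bool.or_eq_false_iff] at hr
    rw [ih' hr.2, ih hr.1]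
  | ite_true a p q s s' t ha _ ih =>
    simp only [Prog.writes, Bool.or_eq_false_iff] at hr
    exact ih hr.1
  | ite_false a p q s s' t ha _ ih =>
    simp only [Prog.writes, Bool.or_eq_false_iff] at hr
    exact ih hr.2
  | loop_step a p s s' s'' t t' ha _ _ ih ih' => rw [ih' hr, ih hr]

/-- Registers that a program does not write keep their contents. -/
theorem wp.frame {p : Prog} (h : wp W p s t₀ Q) :
    wp W p s t₀ fun t s' => Q t s' ∧ ∀ r, p.writes r = false → s'.reg r = s.reg r := by
  obtain ⟨t, s', he, h⟩ := h
  exact ⟨t, s', he, h, fun r hr => he.reg_eq hr⟩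

/-- Repeat `p` as often as the counter `c` says; register `1` has to hold the number `1`. -/
def Prog.repeat (c : ℕ) (p : Prog) : Prog := .loop c (p ;; .op .sub c c 1)

theorem writes_repeat {c : ℕ} {p : Prog} {r : ℕ} :
    (Prog.repeat c p).writes r = (p.writes r || r == c) := rfl

/-- An iteration costs its body plus two units, for the test and for decrementing the counter, and
the final test costs one more. The body is analysed from time 0, so that `B` bounds its own cost.
The invariant is demanded after the decrement, and the frame condition passes on all registers that
the loop does not write. -/
theorem wp_repeat {c : ℕ} {p : Prog} (I : ℕ → State → Prop) (B n : ℕ) (hc : p.writes c = false)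
    (h1 : p.writes 1 = false) (hc1 : c ≠ 1) (hs : s.reg c = n) (hs1 : s.reg 1 = 1) (hW : n ≤ W)
    (h0 : I 0 s)
    (hstep : ∀ k < n, ∀ s', I k s' →
      (∀ r, (Prog.repeat c p).writes r = false → s'.reg r = s.reg r) →
      wp W p s' 0 fun t s'' => t ≤ B ∧ I (k + 1) (s''.setReg c (n - (k + 1))))
    (hQ : ∀ t s', t ≤ t₀ + n * (B + 2) + 1 → I n s' →
      (∀ r, (Prog.repeat c p).writes r = false → s'.reg r = s.reg r) → Q t s') :
    wp W (.repeat c p) s t₀ Q := by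
  have key : ∀ j k, k + j = n → ∀ s' t, s'.reg c = j → I k s' →
      (∀ r, (Prog.repeat c p).writes r = false → s'.reg r = s.reg r) →
      t ≤ t₀ + k * (B + 2) → wp W (.repeat c p) s' t Q := by
    intro j
    induction j with
    | zero =>
      intro k hk s' t hs' hI hfr ht
      obtain rfl : k = n := by omega
      refine wp_loop.2 ⟨fun h => absurd hs' h, fun _ => hQ _ _ (by omega) hI hfr⟩
    | succ j ih =>
      intro k hk s' t hs' hI hfr ht
      refine wp_loop.2 ⟨fun _ => ?_, fun h => by omega⟩
      rw [wp_seq]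
      refine wp_time ((hstep k (by omega) s' hI hfr).frame.mono ?_)
      rintro t' s'' ⟨⟨ht', hI'⟩, hfr'⟩
      have e1 : s''.reg 1 = 1 := by
        rw [hfr' 1 h1, hfr 1 (by simp [writes_repeat, h1, Ne.symm hc1]), hs1]
      have ec : s''.reg c = j + 1 := by rw [hfr' c hc, hs']
      have e : Op.eval .sub (s''.reg c) (s''.reg 1) = n - (k + 1) := by
        simp only [Op.eval, e1, ec]; omega
      rw [wp_op, e]
      refine ⟨by omega, ih (k + 1) (by omega) _ _ (by simp; omega) hI' ?_ ?_⟩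
      · intro r hr
        have hr' := hr
        simp only [writes_repeat, Bool.or_eq_false_iff, beq_eq_false_iff_ne] at hr
        simp only [State.setReg_reg, hr.2, if_false]
        rw [hfr' r hr.1, hfr r hr']
      · rw [Nat.add_mul]; omega
  exact key n 0 (by omega) s t₀ hs h0 (fun _ _ => rfl) (by omega)

end RAM

/-! ### Simulation with a clock and a bound on the words

The simulated machine has its register `j` in register `j + 40` and its memory from cell `rBase` on.
The simulation stops as soon as its clock runs out or a value above `rBound` would be written. -/

namespace RAM

/-- holds the number `1` -/
notation "rOne" => 1
/-- first memory cell of the simulated machine -/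
notation "rBase" => 11
/-- nonzero as long as the simulation has not been stopped -/
notation "rAlive" => 30
/-- number of time units that are left -/
notation "rClock" => 31
/-- largest word of the simulated machine -/
notation "rBound" => 32
/-- the value that is to be written -/
notation "rValue" => 33
notation "rAux" => 34
/-- controls the simulated loops -/
notation "rCond" => 35

namespace Prog

/-- Use up one time unit, or stop the simulation. -/
def tick : Prog := .ite rClock (.op .sub rClock rClock rOne) (.const rAlive 0)

/-- Compute a value into `rValue` and, if it is not too large, process it by `commit`. -/
def guarded (compute commit : Prog) : Prog :=
  tick ;; .ite rAlive
    (compute ;; .op .sub rAux rValue rBound ;; .ite rAux (.const rAlive 0) commit) .skip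

/-- Copy register `a` of the simulated machine to `rCond`, or `0` if the simulation was stopped. -/
def setCond (a : ℕ) : Prog := .ite rAlive (.copy rCond (a + 40)) (.const rCond 0)

/-- The simulation of a program. -/
def sim : Prog → Prog
  | .skip => tick
  | .const d k => guarded (.const rValue k) (.copy (d + 40) rValue)
  | .op o d a b => guarded (.op o rValue (a + 40) (b + 40)) (.copy (d + 40) rValue)
  | .load d a => guarded (.op .add rAux rBase (a + 40) ;; .load rValue rAux)
      (.copy (d + 40) rValue)
  | .store a b => guarded (.copy rValue (b + 40))
      (.op .add rAux rBase (a + 40) ;; .store rAux rValue)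
  | .seq p q => sim p ;; sim q
  | .ite a p q => tick ;; .ite (a + 40) (sim p) (sim q)
  | .loop a p => tick ;; setCond a ;; .loop rCond (sim p ;; tick ;; setCond a)

/-- The largest constant in a program. -/
def maxConst : Prog → ℕ
  | .const _ k => k
  | .seq p q => max p.maxConst q.maxConst
  | .ite _ p q => max p.maxConst q.maxConst
  | .loop _ p => p.maxConst
  | _ => 0

/-- The time that the simulation takes for one time unit of the simulated machine. -/
def simCost : Prog → ℕ
  | .seq p q => p.simCost + q.simCost
  | .ite _ p q => p.simCost + q.simCost + 3
  | .loop _ p => p.simCost + 12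
  | _ => 12

theorem writes_sim {p : Prog} {r : ℕ} (hr : r < 30) : p.sim.writes r = false := by
  induction p with
  | seq p q hp hq => simp [sim, writes, hp, hq]
  | ite a p q hp hq =>
    simp only [sim, tick, writes, hp, hq, Bool.or_false, Bool.or_eq_false_iff,
      beq_eq_false_iff_ne]
    omega
  | loop a p hp =>
    simp only [sim, tick, setCond, copy, writes, hp, Bool.false_or, Bool.or_eq_false_iff,
      beq_eq_false_iff_ne]
    omega
  | _ =>
    simp only [sim, guarded, tick, copy, writes, Bool.or_false, Bool.or_eq_false_iff,
      beq_eq_false_iff_ne]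
    omega

end Prog

/-- The state `s'` of the simulation represents the state `s` of the simulated machine, all of whose
words are at most `M`. -/
structure Simulates (base bound M : ℕ) (s s' : State) : Prop where
  reg : ∀ j, s'.reg (j + 40) = s.reg j
  mem : ∀ x, s'.mem (base + x) = s.mem x
  one : s'.reg rOne = 1
  base : s'.reg rBase = base
  bound : s'.reg rBound = bound
  alive : s'.reg rAlive = 1
  reg_le : ∀ j, s.reg j ≤ M
  mem_le : ∀ x, s.mem x ≤ M

/-- The simulation was stopped. -/
structure Stopped (W : ℕ) (s : State) : Prop where
  one : s.reg rOne = 1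
  alive : s.reg rAlive = 0
  clock : s.reg rClock ≤ W

/-- The product accounts for `M * M`; `lor` and `xor` stay below the next power of two, which is at
most `2 * M + 2`. This is the room the simulating machine needs to compute a value before comparing
it with the bound of the simulated machine. -/
theorem Op.eval_le (o : Op) {x y M : ℕ} (hx : x ≤ M) (hy : y ≤ M) :
    o.eval x y ≤ M * M + 2 * M + 1 := by
  have hlog : 2 ^ (Nat.log 2 M + 1) ≤ 2 * M + 2 := by
    rcases M.eq_zero_or_pos with rfl | hM
    · simp
    · have := Nat.pow_log_le_self 2 hM.ne'
      rw [pow_succ]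
      omega
  have hx' := hx.trans_lt (Nat.lt_pow_succ_log_self one_lt_two M)
  have hy' := hy.trans_lt (Nat.lt_pow_succ_log_self one_lt_two M)
  cases o with
  | add => exact (Nat.add_le_add hx hy).trans (by omega)
  | sub => exact (Nat.sub_le x y).trans (by omega)
  | mul => exact (Nat.mul_le_mul hx hy).trans (by omega)
  | div => exact (Nat.div_le_self x y).trans (by omega)
  | mod => exact (Nat.mod_le x y).trans (by omega)
  | land => exact Nat.and_le_left.trans (by omega)
  | lor => have := Nat.or_lt_two_pow hx' hy'; simp only [Op.eval]; omega
  | xor => have := Nat.xor_lt_two_pow hx' hy'; simp only [Op.eval]; omega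

variable {W : ℕ} {s : State} {t₀ : ℕ} {Q : ℕ → State → Prop}

theorem wp_tick_pos (h : s.reg rClock ≠ 0) (h1 : s.reg rOne = 1) (hW : s.reg rClock ≤ W)
    (hQ : Q (t₀ + 2) (s.setReg rClock (s.reg rClock - 1))) : wp W .tick s t₀ Q := by
  refine wp_ite.2 ⟨fun _ => wp_op.2 ?_, fun h' => absurd h' h⟩
  simp only [Op.eval, h1]
  exact ⟨by omega, hQ⟩

theorem wp_tick_zero (h : s.reg rClock = 0) (hQ : Q (t₀ + 2) (s.setReg rAlive 0)) :
    wp W .tick s t₀ Q :=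
  wp_ite.2 ⟨fun h' => absurd h h', fun _ => wp_const.2 ⟨Nat.zero_le _, hQ⟩⟩

/-- A simulation stopped by an excessive value may have time left, and then the clock still counts
down. Therefore `Stopped` records that the clock fits into a word. -/
theorem wp_tick_stopped (h : Stopped W s)
    (hQ : ∀ s', Stopped W s' → Q (t₀ + 2) s') : wp W .tick s t₀ Q := by
  by_cases hc : s.reg rClock = 0
  · exact wp_tick_zero hc (hQ _ ⟨by simp [h.one], by simp, by simp [h.clock]⟩)
  · refine wp_tick_pos hc h.one h.clock (hQ _ ⟨by simp [h.one], by simp [h.alive], ?_⟩)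
    have := h.clock
    simp only [State.setReg_reg, if_true]
    omega

/-- One register `rCond` serves all simulated loops, even nested ones, because it is refreshed
immediately before each test. The value `0` after a stop makes every pending loop exit at its next
test. -/
theorem wp_setCond_stopped {a : ℕ} (h : Stopped W s)
    (hQ : ∀ s', Stopped W s' → s'.reg rCond = 0 → Q (t₀ + 2) s') :
    wp W (.setCond a) s t₀ Q :=
  wp_ite.2 ⟨fun h' => absurd h.alive h', fun _ => wp_const.2 ⟨Nat.zero_le _, hQ _
    ⟨by simp [h.one], by simp [h.alive], by simp [h.clock]⟩ (by simp)⟩⟩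

theorem wp_guarded_stopped {p q : Prog} (h : Stopped W s)
    (hQ : ∀ s', Stopped W s' → Q (t₀ + 4) s') : wp W (.guarded p q) s t₀ Q :=
  wp_seq.2 (wp_tick_stopped h fun _ hst =>
    wp_ite.2 ⟨fun h' => absurd hst.alive h', fun _ => wp_skip.2 (hQ _ hst)⟩)

/-- A simulation that was stopped has no effect any more. -/
theorem wp_sim_stopped (p : Prog) (h : Stopped W s)
    (hQ : ∀ t s', t ≤ t₀ + p.simCost → Stopped W s' → Q t s') : wp W p.sim s t₀ Q := by
  induction p generalizing s t₀ Q with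
  | skip => exact wp_tick_stopped h fun s' hs' => hQ _ _ (by simp [Prog.simCost]) hs'
  | const | op | load | store =>
    exact wp_guarded_stopped h fun s' hs' => hQ _ _ (by simp [Prog.simCost]) hs'
  | seq p q hp hq =>
    refine wp_seq.2 (hp h fun t s' ht hs' => hq hs' fun t' s'' ht' hs'' => hQ _ _ ?_ hs'')
    simp only [Prog.simCost]
    omega
  | ite a p q hp hq =>
    simp only [Prog.simCost] at hQ
    refine wp_seq.2 (wp_tick_stopped h fun s' hs' => wp_ite.2 ⟨fun _ => ?_, fun _ => ?_⟩)
    · exact hp hs' fun t s' ht hs' => hQ _ _ (by omega) hs'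
    · exact hq hs' fun t s' ht hs' => hQ _ _ (by omega) hs'
  | loop a p hp =>
    simp only [Prog.simCost] at hQ
    exact wp_seq.2 (wp_tick_stopped h fun s₁ h₁ => wp_seq.2 (wp_setCond_stopped h₁
      fun _ h₂ hc => wp_loop.2 ⟨fun h' => absurd hc h', fun _ => hQ _ _ (by omega) h₂⟩))

/-! ### Correctness of the simulation while it is running -/

section

variable {base bound M : ℕ} {s' : State}

theorem Simulates.setReg {d x : ℕ} (h : Simulates base bound M s s') (hd : d < 40) (h1 : d ≠ rOne)
    (h11 : d ≠ rBase) (h30 : d ≠ rAlive) (h32 : d ≠ rBound) :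
    Simulates base bound M s (s'.setReg d x) where
  reg j := by simp [h.reg, show j + 40 ≠ d by omega]
  mem := h.mem
  one := by simp [h.one, h1.symm]
  base := by simp [h.base, h11.symm]
  bound := by simp [h.bound, h32.symm]
  alive := by simp [h.alive, h30.symm]
  reg_le := h.reg_le
  mem_le := h.mem_le

theorem Simulates.setReg_both {d x : ℕ} (h : Simulates base bound M s s') (hx : x ≤ M) :
    Simulates base bound M (s.setReg d x) (s'.setReg (d + 40) x) where
  reg j := by simp [h.reg]
  mem := h.mem
  one := by simp [h.one]
  base := by simp [h.base]
  bound := by simp [h.bound]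
  alive := by simp [h.alive]
  reg_le j := by
    have := h.reg_le j
    simp only [State.setReg_reg]
    split_ifs <;> assumption
  mem_le := h.mem_le

theorem Simulates.setMem_both {a x : ℕ} (h : Simulates base bound M s s') (hx : x ≤ M) :
    Simulates base bound M (s.setMem a x) (s'.setMem (base + a) x) where
  reg := h.reg
  mem y := by simp [Function.update_apply, h.mem]
  one := h.one
  base := h.base
  bound := h.bound
  alive := h.alive
  reg_le := h.reg_le
  mem_le y := by
    have := h.mem_le y
    simp only [State.setMem_mem, Function.update_apply]
    split_ifs <;> assumption

/-- What is known after the simulation of `p` from `s` with `τ` time units on the clock: either `p`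
halts within this time and the simulation has followed it, or the simulation was stopped. -/
def SimPost (W base bound M : ℕ) (p : Prog) (cost : ℕ) (s : State) (τ t₀ T : ℕ) (s' : State) :
    Prop :=
  (∃ t s₁, t ≤ τ ∧ Exec bound p s t s₁ ∧ Simulates base bound M s₁ s' ∧
    s'.reg rClock = τ - t ∧ T ≤ t₀ + cost * t) ∨
  (Stopped W s' ∧ (∀ t s₁, Exec bound p s t s₁ → τ < t) ∧ T ≤ t₀ + cost * (τ + 1))

theorem wp_tick {τ : ℕ} (h : Simulates base bound M s s') (hc : s'.reg rClock = τ) (hτ : τ ≤ W)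
    (hpos : ∀ s'', 0 < τ → Simulates base bound M s s'' → s''.reg rClock = τ - 1 →
      Q (t₀ + 2) s'')
    (hzero : ∀ s'', τ = 0 → Stopped W s'' → Q (t₀ + 2) s'') : wp W .tick s' t₀ Q := by
  by_cases h0 : τ = 0
  · exact wp_tick_zero (by rw [hc, h0])
      (hzero _ h0 ⟨by simp [h.one], by simp, by simp [hc, hτ]⟩)
  · refine wp_tick_pos (by omega) h.one (by omega) (hpos _ (by omega)
      (h.setReg (by norm_num) (by norm_num) (by norm_num) (by norm_num) (by norm_num)) ?_)
    simp [hc]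

/-- Simulation of an instruction that would write the value `x`. -/
theorem wp_guarded {τ x : ℕ} {p q i : Prog} {s₁ : State} (h : Simulates base bound M s s')
    (hc : s'.reg rClock = τ) (hτ : τ ≤ W)
    (hex : ∀ t s₂, Exec bound i s t s₂ ↔ x ≤ bound ∧ t = 1 ∧ s₂ = s₁)
    (hp : ∀ s'' t, Simulates base bound M s s'' → s''.reg rClock = τ - 1 →
      wp W p s'' t fun t' s₂ => t' ≤ t + 2 ∧ Simulates base bound M s s₂ ∧
        s₂.reg rClock = τ - 1 ∧ s₂.reg rValue = x ∧ x ≤ W)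
    (hq : ∀ s'' t, Simulates base bound M s s'' → s''.reg rClock = τ - 1 →
      s''.reg rValue = x → x ≤ bound →
      wp W q s'' t fun t' s₂ => t' ≤ t + 2 ∧ Simulates base bound M s₁ s₂ ∧
        s₂.reg rClock = τ - 1) :
    wp W (.guarded p q) s' t₀ (SimPost W base bound M i 12 s τ t₀) := by
  -- Both reasons for stopping are sound: with an empty clock even one time unit is too much, and if
  -- the value exceeds the bound, then the instruction has no result, so the claim about its runs is
  -- vacuous.
  have hno : ∀ {s'' : State} {T : ℕ}, (τ = 0 ∨ bound < x) → Stopped W s'' →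
      T ≤ t₀ + 12 * (τ + 1) → SimPost W base bound M i 12 s τ t₀ T s'' := by
    intro s'' T hor hs'' hT
    refine .inr ⟨hs'', fun t s₂ he => ?_, hT⟩
    obtain ⟨h₁, rfl, -⟩ := (hex _ _).1 he
    omega
  refine wp_seq.2 (wp_tick h hc hτ ?_ ?_)
  · intro s₂ hpos h₂ hc₂
    refine wp_ite.2 ⟨fun _ => ?_, fun h' => by simp [h₂.alive] at h'⟩
    refine wp_seq.2 ((hp s₂ _ h₂ hc₂).mono ?_)
    rintro t s₃ ⟨ht, h₃, hc₃, hv, hxW⟩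
    refine wp_seq.2 (wp_op.2 ?_)
    simp only [Op.eval, hv, h₃.bound]
    refine ⟨by omega, wp_ite.2 ⟨fun hb => wp_const.2 ⟨by omega, ?_⟩, fun hb => ?_⟩⟩
    · simp only [State.setReg_reg, if_true] at hb
      refine hno (.inr (by omega)) ⟨by simp [h₃.one], by simp, ?_⟩ (by omega)
      simp only [State.setReg_reg, show (31 : ℕ) ≠ 30 by norm_num,
        show (31 : ℕ) ≠ 34 by norm_num, if_false]
      omega
    · simp only [State.setReg_reg, if_true] at hb
      refine (hq _ _ (h₃.setReg (by norm_num) (by norm_num) (by norm_num) (by norm_num)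
        (by norm_num)) (by simpa using hc₃) (by simpa using hv) (by omega)).mono ?_
      rintro t' s₄ ⟨ht', h₄, hc₄⟩
      exact .inl ⟨1, s₁, hpos, (hex _ _).2 ⟨by omega, rfl, rfl⟩, h₄, hc₄, by omega⟩
  · intro s₂ h0 h₂
    exact wp_ite.2 ⟨fun h' => absurd h₂.alive h', fun _ => wp_skip.2 (hno (.inl h0) h₂ (by omega))⟩

theorem wp_copy_value {d x t c : ℕ} (h : Simulates base bound M s s') (hbM : bound ≤ M)
    (hMW : M ≤ W) (hc : s'.reg rClock = c) (hv : s'.reg rValue = x) (hx : x ≤ bound) :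
    wp W (.copy (d + 40) rValue) s' t fun t' s₂ => t' ≤ t + 2 ∧
      Simulates base bound M (s.setReg d x) s₂ ∧ s₂.reg rClock = c := by
  refine wp_copy.2 ⟨by omega, by omega, ?_, by simp [hc]⟩
  rw [hv]
  exact h.setReg_both (hx.trans hbM)

theorem wp_setCond {a : ℕ} (h : Simulates base bound M s s') (hMW : M ≤ W)
    (hQ : ∀ s'', Simulates base bound M s s'' → s''.reg rCond = s.reg a →
      s''.reg rClock = s'.reg rClock → Q (t₀ + 2) s'') : wp W (.setCond a) s' t₀ Q := by
  refine wp_ite.2 ⟨fun _ => wp_copy.2 ?_, fun h' => by simp [h.alive] at h'⟩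
  rw [h.reg]
  exact ⟨(h.reg_le a).trans hMW, hQ _ (h.setReg (by norm_num) (by norm_num) (by norm_num)
    (by norm_num) (by norm_num)) (by simp) (by simp)⟩

theorem Exec.loop_iff {W a t : ℕ} {p : Prog} {s s' : State} : Exec W (.loop a p) s t s' ↔
    (s.reg a = 0 ∧ t = 1 ∧ s' = s) ∨ (s.reg a ≠ 0 ∧ ∃ t₁ t₂ s₁, Exec W p s t₁ s₁ ∧
      Exec W (.loop a p) s₁ t₂ s' ∧ t = t₁ + t₂ + 1) := by
  constructor
  · intro h
    cases h with
    | loop_done _ _ _ ha => exact .inl ⟨ha, rfl, rfl⟩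
    | loop_step _ _ _ s₁ _ t₁ t₂ ha h hrest => exact .inr ⟨ha, t₁, t₂, s₁, h, hrest, rfl⟩
  · rintro (⟨ha, rfl, rfl⟩ | ⟨ha, t₁, t₂, s₁, h, hrest, rfl⟩)
    · exact .loop_done _ _ _ ha
    · exact .loop_step _ _ _ _ _ _ _ ha h hrest

/-- The simulation is correct. -/
theorem wp_sim (p : Prog) (hbM : bound ≤ M) (hMW : M * M + 2 * M + base + 1 ≤ W)
    (hpW : p.maxConst ≤ W) {τ : ℕ} (hτ : τ ≤ W) (h : Simulates base bound M s s')
    (hc : s'.reg rClock = τ) :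
    wp W p.sim s' t₀ (SimPost W base bound M p p.simCost s τ t₀) := by
  have hMW' : M ≤ W := by omega
  induction p generalizing s s' τ t₀ with
  | skip =>
    refine wp_tick h hc hτ (fun s'' h0 h'' hc'' => ?_) (fun s'' h0 h'' => ?_)
    · exact .inl ⟨1, s, h0, .skip s, h'', hc'', by simp [Prog.simCost]⟩
    · refine .inr ⟨h'', fun t s₁ he => ?_, by simp only [Prog.simCost]; omega⟩
      cases he
      omega
  | const d k =>
    refine wp_guarded h hc hτ (x := k) (s₁ := s.setReg d k) ?_ ?_ ?_
    · intro t s₂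
      constructor
      · intro he
        cases he with
        | const _ _ _ hk => exact ⟨hk, rfl, rfl⟩
      · rintro ⟨hk, rfl, rfl⟩
        exact .const _ _ _ hk
    · intro s'' t h'' hc''
      exact wp_const.2 ⟨hpW, by omega, h''.setReg (by norm_num) (by norm_num) (by norm_num)
        (by norm_num) (by norm_num), by simp [hc''], by simp, hpW⟩
    · intro s'' t h'' hc'' hv hx
      exact wp_copy_value h'' hbM hMW' hc'' hv hx
  | op o d a b =>
    have hle : o.eval (s.reg a) (s.reg b) ≤ W :=
      (o.eval_le (h.reg_le a) (h.reg_le b)).trans (by omega)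
    refine wp_guarded h hc hτ (x := o.eval (s.reg a) (s.reg b))
      (s₁ := s.setReg d (o.eval (s.reg a) (s.reg b))) ?_ ?_ ?_
    · intro t s₂
      constructor
      · intro he
        cases he with
        | op _ _ _ _ _ hk => exact ⟨hk, rfl, rfl⟩
      · rintro ⟨hk, rfl, rfl⟩
        exact .op _ _ _ _ _ hk
    · intro s'' t h'' hc''
      rw [wp_op, h''.reg, h''.reg]
      exact ⟨hle, by omega, h''.setReg (by norm_num) (by norm_num) (by norm_num)
        (by norm_num) (by norm_num), by simp [hc''], by simp, hle⟩
    · intro s'' t h'' hc'' hv hx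
      exact wp_copy_value h'' hbM hMW' hc'' hv hx
  | load d a =>
    have hle : s.mem (s.reg a) ≤ W := (h.mem_le _).trans hMW'
    have ha := h.reg_le a
    refine wp_guarded h hc hτ (x := s.mem (s.reg a))
      (s₁ := s.setReg d (s.mem (s.reg a))) ?_ ?_ ?_
    · intro t s₂
      constructor
      · intro he
        cases he with
        | load _ _ _ hk => exact ⟨hk, rfl, rfl⟩
      · rintro ⟨hk, rfl, rfl⟩
        exact .load _ _ _ hk
    · intro s'' t h'' hc''
      rw [wp_seq, wp_op, h''.reg, h''.base]
      simp only [Op.eval, wp_load, State.setReg_reg, if_true, State.setReg_mem, h''.mem]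
      exact ⟨by omega, hle, by omega, (h''.setReg (by norm_num) (by norm_num) (by norm_num)
        (by norm_num) (by norm_num)).setReg (by norm_num) (by norm_num) (by norm_num)
        (by norm_num) (by norm_num), by simp [hc''], trivial, hle⟩
    · intro s'' t h'' hc'' hv hx
      exact wp_copy_value h'' hbM hMW' hc'' hv hx
  | store a b =>
    have hle : s.reg b ≤ W := (h.reg_le _).trans hMW'
    have ha := h.reg_le a
    refine wp_guarded h hc hτ (x := s.reg b)
      (s₁ := s.setMem (s.reg a) (s.reg b)) ?_ ?_ ?_
    · intro t s₂
      constructor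
      · intro he
        cases he with
        | store _ _ _ hk => exact ⟨hk, rfl, rfl⟩
      · rintro ⟨hk, rfl, rfl⟩
        exact .store _ _ _ hk
    · intro s'' t h'' hc''
      rw [wp_copy, h''.reg]
      exact ⟨hle, by omega, h''.setReg (by norm_num) (by norm_num) (by norm_num)
        (by norm_num) (by norm_num), by simp [hc''], by simp, hle⟩
    · intro s'' t h'' hc'' hv hx
      rw [wp_seq, wp_op, h''.reg, h''.base]
      have h₂ := (h''.setReg (d := rAux) (x := base + s.reg a) (by norm_num) (by norm_num)
        (by norm_num) (by norm_num) (by norm_num)).setMem_both (a := s.reg a) (hx.trans hbM)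
      simp only [Op.eval, wp_store, State.setReg_reg, if_true, hv,
        show (33 : ℕ) ≠ 34 by norm_num, if_false]
      exact ⟨by omega, hle, by omega, h₂, by simp [hc'']⟩
  | seq p q ihp ihq =>
    simp only [Prog.maxConst, max_le_iff] at hpW
    refine wp_seq.2 ((ihp hpW.1 hτ h hc).mono ?_)
    rintro T s₁' (⟨t, s₁, ht, he, h₁, hc₁, hT⟩ | ⟨hst, hno, hT⟩)
    · refine (ihq hpW.2 (by omega) h₁ hc₁).mono ?_
      rintro T' s₂' (⟨t', s₂, ht', he', h₂, hc₂, hT'⟩ | ⟨hst, hno, hT'⟩)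
      · refine .inl ⟨t + t', s₂, by omega, .seq _ _ _ _ _ _ _ he he', h₂, by omega, ?_⟩
        simp only [Prog.simCost]
        nlinarith
      · refine .inr ⟨hst, fun t'' s₂ he'' => ?_, ?_⟩
        · cases he'' with
          | seq _ _ _ _ _ t₁ t₂ g g' =>
            -- Determinism identifies the first half of an arbitrary run with the run of `p` that
            -- was simulated.
            obtain ⟨rfl, rfl⟩ := he.unique g
            have := hno _ _ g'
            omega
        · have : q.simCost * (τ - t + 1) ≤ q.simCost * (τ + 1) := by gcongr; omega
          have : p.simCost * t ≤ p.simCost * (τ + 1) := by gcongr; omega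
          simp only [Prog.simCost, Nat.add_mul]
          omega
    · refine wp_sim_stopped q hst fun T' s₂' hT' hst' => .inr ⟨hst', fun t'' s₂ he'' => ?_, ?_⟩
      · cases he'' with
        | seq _ _ _ _ _ t₁ t₂ g g' =>
          have := hno _ _ g
          omega
      · have : q.simCost * 1 ≤ q.simCost * (τ + 1) := by gcongr; omega
        simp only [Prog.simCost, Nat.add_mul]
        omega
  | ite a p q ihp ihq =>
    simp only [Prog.maxConst, max_le_iff] at hpW
    have hex : ∀ t s₁, Exec bound (.ite a p q) s t s₁ → ∃ t', t = t' + 1 ∧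
        (s.reg a ≠ 0 ∧ Exec bound p s t' s₁ ∨ s.reg a = 0 ∧ Exec bound q s t' s₁) := by
      intro t s₁ he
      cases he with
      | ite_true _ _ _ _ _ t ha he => exact ⟨t, rfl, .inl ⟨ha, he⟩⟩
      | ite_false _ _ _ _ _ t ha he => exact ⟨t, rfl, .inr ⟨ha, he⟩⟩
    refine wp_seq.2 (wp_tick h hc hτ (fun s'' h0 h'' hc'' => ?_) (fun s'' h0 h'' => ?_))
    · refine wp_ite.2 ?_
      rw [h''.reg]
      refine ⟨fun ha => ?_, fun ha => ?_⟩
      · refine (ihp hpW.1 (by omega) h'' hc'').mono ?_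
        rintro T s₁' (⟨t, s₁, ht, he, h₁, hc₁, hT⟩ | ⟨hst, hno, hT⟩)
        · refine .inl ⟨t + 1, s₁, by omega, .ite_true _ _ _ _ _ _ ha he, h₁, by omega, ?_⟩
          simp only [Prog.simCost]
          nlinarith
        · refine .inr ⟨hst, fun t s₁ he => ?_, ?_⟩
          · obtain ⟨t', rfl, ⟨-, he⟩ | ⟨ha', -⟩⟩ := hex _ _ he
            · have := hno _ _ he
              omega
            · exact absurd ha' ha
          · rw [Nat.sub_add_cancel h0] at hT
            simp only [Prog.simCost]
            nlinarith
      · refine (ihq hpW.2 (by omega) h'' hc'').mono ?_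
        rintro T s₁' (⟨t, s₁, ht, he, h₁, hc₁, hT⟩ | ⟨hst, hno, hT⟩)
        · refine .inl ⟨t + 1, s₁, by omega, .ite_false _ _ _ _ _ _ ha he, h₁, by omega, ?_⟩
          simp only [Prog.simCost]
          nlinarith
        · refine .inr ⟨hst, fun t s₁ he => ?_, ?_⟩
          · obtain ⟨t', rfl, ⟨ha', -⟩ | ⟨-, he⟩⟩ := hex _ _ he
            · exact absurd ha ha'
            · have := hno _ _ he
              omega
          · rw [Nat.sub_add_cancel h0] at hT
            simp only [Prog.simCost]
            nlinarith
    · have hno : ∀ t s₁, Exec bound (.ite a p q) s t s₁ → τ < t := by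
        intro t s₁ he
        obtain ⟨t', rfl, -⟩ := hex _ _ he
        omega
      have : p.simCost + q.simCost + 3 ≤ (p.simCost + q.simCost + 3) * (τ + 1) :=
        Nat.le_mul_of_pos_right _ (by omega)
      refine wp_ite.2 ⟨fun _ => ?_, fun _ => ?_⟩
      · exact wp_sim_stopped p h'' fun T' s₂' hT' hst' =>
          .inr ⟨hst', hno, by simp only [Prog.simCost]; omega⟩
      · exact wp_sim_stopped q h'' fun T' s₂' hT' hst' =>
          .inr ⟨hst', hno, by simp only [Prog.simCost]; omega⟩
  | loop a p ih =>
    simp only [Prog.maxConst] at hpW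
    -- one test of the condition, followed by the rest of the loop
    have key : ∀ τ ≤ W, ∀ s s' t₀, Simulates base bound M s s' → s'.reg rClock = τ →
        wp W .tick s' t₀ fun t s₁ => wp W (.setCond a) s₁ t fun t s₂ =>
          wp W (.loop rCond (p.sim ;; .tick ;; .setCond a)) s₂ t
            (SimPost W base bound M (.loop a p) (p.simCost + 12) s τ t₀) := by
      intro τ
      -- The simulated loop need not terminate, so the induction is on the clock: each test of the
      -- condition is preceded by a tick.
      induction τ using Nat.strong_induction_on with
      | _ τ ihτ =>
      intro hτ s s' t₀ h hc
      refine wp_tick h hc hτ (fun s₁ h0 h₁ hc₁ => ?_) (fun s₁ h0 h₁ => ?_)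
      · refine wp_setCond h₁ hMW' fun s₂ h₂ hcond hc₂ => wp_loop.2 ?_
        rw [hcond]
        refine ⟨fun ha => ?_, fun ha => ?_⟩
        · refine wp_seq.2 ((ih hpW (τ := τ - 1) (by omega) h₂ (by omega)).mono ?_)
          rintro T s₃' (⟨t, s₃, ht, he, h₃, hc₃, hT⟩ | ⟨hst, hno, hT⟩)
          · simp only [wp_seq]
            refine (ihτ (τ - 1 - t) (by omega) (by omega) s₃ s₃' T h₃ hc₃).mono fun _ _ hw =>
              hw.mono fun _ _ hw => hw.mono ?_
            rintro T' s₄' (⟨t', s₄, ht', he', h₄, hc₄, hT'⟩ | ⟨hst, hno, hT'⟩)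
            · refine .inl ⟨t + t' + 1, s₄, by omega, .loop_step _ _ _ _ _ _ _ ha he he', h₄,
                by omega, ?_⟩
              have : (p.simCost + 12) * (t + t' + 1) =
                p.simCost * t + 12 * t + (p.simCost + 12) * t' + p.simCost + 12 := by ring
              omega
            · refine .inr ⟨hst, fun t'' s₄ he'' => ?_, ?_⟩
              · rw [Exec.loop_iff] at he''
                obtain ⟨ha', -⟩ | ⟨-, t₁, t₂, s₅, g, g', rfl⟩ := he''
                · exact absurd ha' ha
                · obtain ⟨rfl, rfl⟩ := he.unique g
                  have := hno _ _ g'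
                  omega
              · obtain ⟨r, rfl⟩ : ∃ r, τ = t + 1 + r := ⟨τ - 1 - t, by omega⟩
                rw [show t + 1 + r - 1 - t = r by omega] at hT'
                have : (p.simCost + 12) * (t + 1 + r + 1) =
                  p.simCost * t + 12 * t + (p.simCost + 12) * (r + 1) + p.simCost + 12 := by ring
                omega
          · simp only [wp_seq]
            refine wp_tick_stopped hst fun s₄ h₄ => wp_setCond_stopped h₄ fun s₅ h₅ hcond =>
              wp_loop.2 ⟨fun h' => absurd hcond h', fun _ => .inr ⟨h₅, fun t'' s₄ he'' => ?_, ?_⟩⟩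
            · rw [Exec.loop_iff] at he''
              obtain ⟨ha', -⟩ | ⟨-, t₁, t₂, s₅, g, g', rfl⟩ := he''
              · exact absurd ha' ha
              · have := hno _ _ g
                omega
            · rw [Nat.sub_add_cancel h0] at hT
              have : (p.simCost + 12) * (τ + 1) = p.simCost * τ + 12 * τ + p.simCost + 12 := by
                ring
              omega
        · exact .inl ⟨1, s, h0, .loop_done _ _ _ ha, h₂, by omega, by omega⟩
      · refine wp_setCond_stopped h₁ fun s₂ h₂ hcond =>
          wp_loop.2 ⟨fun h' => absurd hcond h', fun _ => .inr ⟨h₂, fun t'' s₄ he'' => ?_, ?_⟩⟩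
        · rw [Exec.loop_iff] at he''
          obtain ⟨-, rfl, -⟩ | ⟨-, t₁, t₂, s₅, -, -, rfl⟩ := he'' <;> omega
        · rw [h0]
          omega
    rw [Prog.sim, wp_seq]
    refine (key τ hτ s s' t₀ h hc).mono fun _ _ hw => wp_seq.2 hw

end

end RAM

/-! ### Join trees of hypergraphs with a hyperedge that contains all vertices -/

/-- The graph in which every vertex other than `c` is joined to its parent. -/
def parentGraph {V : Type*} (c : V) (f : V → V) : SimpleGraph V :=
  SimpleGraph.fromRel fun x y => x ≠ c ∧ y = f x

theorem parentGraph_adj_parent {V : Type*} {c : V} {f : V → V} {x : V} (hx : x ≠ c)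
    (hf : f x ≠ x) : (parentGraph c f).Adj x (f x) := by
  rw [parentGraph, SimpleGraph.fromRel_adj]
  exact ⟨hf.symm, .inl ⟨hx, rfl⟩⟩

theorem parentGraph_edgeSet_subset {V : Type*} (c : V) (f : V → V) :
    (parentGraph c f).edgeSet ⊆ (fun x => s(x, f x)) '' {x | x ≠ c} := by
  intro e he
  induction e with
  | _ x y =>
    rw [SimpleGraph.mem_edgeSet, parentGraph, SimpleGraph.fromRel_adj] at he
    obtain ⟨-, ⟨h, rfl⟩ | ⟨h, rfl⟩⟩ := he
    · exact ⟨x, h, rfl⟩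
    · exact ⟨y, h, Sym2.eq_swap⟩

/-- Each vertex other than `c` contributes at most one edge, so there are at most `|V| - 1` edges,
and a connected graph with so few edges is a tree. -/
theorem parentGraph_isTree {V : Type*} [Finite V] {c : V} {f : V → V}
    (h : (parentGraph c f).Connected) : (parentGraph c f).IsTree := by
  rw [SimpleGraph.isTree_iff_connected_and_card]
  refine ⟨h, le_antisymm ?_ h.card_vert_le_card_edgeSet_add_one⟩
  have h₁ : (parentGraph c f).edgeSet.ncard ≤ ({x | x ≠ c} : Set V).ncard :=
    (Set.ncard_le_ncard (parentGraph_edgeSet_subset c f) (Set.toFinite _)).trans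
      (Set.ncard_image_le (Set.toFinite _))
  have h₂ : ({x | x ≠ c} : Set V).ncard + 1 = Nat.card V := by
    have := Set.ncard_add_ncard_compl ({c} : Set V)
    rw [Set.ncard_singleton, add_comm] at this
    exact this
  rw [Nat.card_coe_set_eq]
  omega

/-- Following `f` at most twice leads to `c`, and closure of `S` under `f` keeps the path inside
`S`. The condition `f (f x) = c` also covers children of `c`, where it says `f c = c`. -/
theorem parentGraph_induce_reachable {V : Type*} {c : V} {f : V → V}
    (hf : ∀ x ≠ c, f x ≠ x ∧ f (f x) = c) {S : Set V} (hc : c ∈ S) (hS : ∀ x ∈ S, f x ∈ S)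
    (x : S) : ((parentGraph c f).induce S).Reachable x ⟨c, hc⟩ := by
  have hstep : ∀ x : S, (x : V) ≠ c →
      ((parentGraph c f).induce S).Reachable x ⟨f x, hS x x.2⟩ := fun x hx =>
    SimpleGraph.Adj.reachable (G := (parentGraph c f).induce S)
      (SimpleGraph.comap_adj.2 (parentGraph_adj_parent hx (hf x hx).1))
  by_cases hx : (x : V) = c
  · obtain ⟨x, hxS⟩ := x
    obtain rfl : x = c := hx
    rfl
  · refine (hstep x hx).trans ?_
    by_cases hx' : f x = c
    · simp only [hx']
      rfl
    · simpa only [(hf x hx).2] using hstep ⟨f x, hS x x.2⟩ hx'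

theorem parentGraph_induce_preconnected {V : Type*} {c : V} {f : V → V}
    (hf : ∀ x ≠ c, f x ≠ x ∧ f (f x) = c) {S : Set V} (hc : c ∈ S) (hS : ∀ x ∈ S, f x ∈ S) :
    ((parentGraph c f).induce S).Preconnected := fun x y =>
  (parentGraph_induce_reachable hf hc hS x).trans (parentGraph_induce_reachable hf hc hS y).symm

theorem parentGraph_isTree_of_depth_le_two {V : Type*} [Finite V] {c : V} {f : V → V}
    (hf : ∀ x ≠ c, f x ≠ x ∧ f (f x) = c) : (parentGraph c f).IsTree := by
  have : Nonempty V := ⟨c⟩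
  refine parentGraph_isTree ⟨fun x y => ?_⟩
  exact (parentGraph_induce_preconnected hf (S := Set.univ) trivial (fun _ _ => trivial)
    ⟨x, trivial⟩ ⟨y, trivial⟩).map (SimpleGraph.Embedding.induce Set.univ).toHom

namespace FinHypergraph

variable {H : FinHypergraph} {c : Fin H.m}

/-- If the centre contains all vertices, then a star is a join tree, and so is a star in which
hyperedges have been moved from the centre to hyperedges that contain them. -/
theorem isJoinTree_parentGraph (hc : ∀ v, v ∈ H.edge c) {f : Fin H.m → Fin H.m}
    (hf : ∀ i ≠ c, f i ≠ i ∧ f (f i) = c) (hsub : ∀ i, H.edge i ⊆ H.edge (f i)) :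
    H.IsJoinTree (parentGraph c f) :=
  ⟨parentGraph_isTree_of_depth_le_two hf, fun v =>
    parentGraph_induce_preconnected hf (hc v) fun i hi => hsub i hi⟩

theorem isJoinTree_star (hc : ∀ v, v ∈ H.edge c) :
    H.IsJoinTree (parentGraph c fun _ => c) :=
  isJoinTree_parentGraph hc (fun _ hi => ⟨hi.symm, rfl⟩) fun _ v _ => hc v

/-- An edge of a join tree that avoids a hyperedge containing all vertices joins two comparable
hyperedges. -/
theorem IsJoinTree.subset_or_subset {T : SimpleGraph (Fin H.m)} (hT : H.IsJoinTree T)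
    (hc : ∀ v, v ∈ H.edge c) {i j : Fin H.m} (hij : T.Adj i j) :
    H.edge i ⊆ H.edge j ∨ H.edge j ⊆ H.edge i := by
  -- Choose a vertex of `E_i` outside `E_j`. The hyperedges containing it form a subtree with `i`
  -- and `c` but without `j`, so the path from `i` to `c` in it survives the deletion of `ij`.
  have key : ∀ i j, T.Adj i j → ¬ H.edge i ⊆ H.edge j →
      (T.deleteEdges {s(i, j)}).Reachable i c := by
    intro i j hij hsub
    obtain ⟨v, hvi, hvj⟩ := Finset.not_subset.1 hsub
    let g : T.induce {k | v ∈ H.edge k} →g T.deleteEdges {s(i, j)} :=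
      { toFun := Subtype.val
        map_rel' := by
          rintro ⟨a, ha⟩ ⟨b, hb⟩ hab
          have hab' : T.Adj a b := hab
          have haj : a ≠ j := by rintro rfl; exact hvj ha
          have hbj : b ≠ j := by rintro rfl; exact hvj hb
          simp [hab', haj, hbj] }
    exact (hT.2 v ⟨i, hvi⟩ ⟨c, hc v⟩).map g
  by_contra! h
  -- Were the hyperedges incomparable, both ends of the deleted edge would still reach `c`, although
  -- an edge of a tree is a bridge.
  have hbridge := SimpleGraph.isAcyclic_iff_forall_adj_isBridge.1 hT.1.isAcyclic hij
  rw [SimpleGraph.isBridge_iff] at hbridge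
  have h₂ := key j i hij.symm h.2
  rw [Sym2.eq_swap] at h₂
  exact hbridge ((key i j hij h.1).trans h₂.symm)

/-- By `IsJoinTree.subset_or_subset`, incomparability forces every edge of every join tree to meet
`c`; the star itself is a join tree and so supplies all of these edges. -/
theorem unionJoinGraph_eq_star (hc : ∀ v, v ∈ H.edge c)
    (h : ∀ i j, i ≠ c → j ≠ c → i ≠ j → ¬ H.edge i ⊆ H.edge j) :
    H.unionJoinGraph = parentGraph c fun _ => c := by
  ext i j
  constructor
  · rintro ⟨T, hT, hij⟩
    rw [parentGraph, SimpleGraph.fromRel_adj]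
    have hne := hij.ne
    by_cases hi : i = c
    · exact ⟨hne, .inr ⟨fun hj => hne (hi.trans hj.symm), hi⟩⟩
    · by_cases hj : j = c
      · exact ⟨hne, .inl ⟨hi, hj⟩⟩
      · exact ((hT.subset_or_subset hc hij).elim (h i j hi hj hne) (h j i hj hi hne.symm)).elim
  · exact fun hij => ⟨_, isJoinTree_star hc, hij⟩

/-- If the hyperedges other than a universal one are pairwise incomparable, then there is only one
join tree. -/
theorem ncard_edgeSet_unionJoinGraph (hc : ∀ v, v ∈ H.edge c)
    (h : ∀ i j, i ≠ c → j ≠ c → i ≠ j → ¬ H.edge i ⊆ H.edge j) :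
    H.unionJoinGraph.edgeSet.ncard + 1 = H.m := by
  rw [unionJoinGraph_eq_star hc h]
  have := ((SimpleGraph.isTree_iff_connected_and_card).1 (isJoinTree_star hc).1).2
  rwa [Nat.card_coe_set_eq, Nat.card_eq_fintype_card, Fintype.card_fin] at this

/-- If one of two hyperedges other than a universal one contains the other, then there is more than
one join tree. -/
theorem le_ncard_edgeSet_unionJoinGraph (hc : ∀ v, v ∈ H.edge c) {i j : Fin H.m} (hi : i ≠ c)
    (hj : j ≠ c) (hij : i ≠ j) (hsub : H.edge i ⊆ H.edge j) :
    H.m ≤ H.unionJoinGraph.edgeSet.ncard := by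
  -- The star with the leaf `i` moved from `c` to `j`. Its edge `ij` is not in the original star and
  -- so adds one to the `m - 1` edges there.
  have hT : H.IsJoinTree (parentGraph c fun k => if k = i then j else c) := by
    refine isJoinTree_parentGraph hc (fun k hk => ?_) fun k => ?_
    · by_cases hki : k = i
      · subst hki
        simp [hij.symm]
      · simp [hki, hi.symm, hk.symm]
    · by_cases hki : k = i
      · subst hki
        simpa using hsub
      · simp only [hki, if_false]
        exact fun v _ => hc v
  have hmem : s(i, j) ∈ H.unionJoinGraph.edgeSet := by
    refine ⟨_, hT, ?_⟩
    have := parentGraph_adj_parent (f := fun k => if k = i then j else c) hi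
      (by simpa using hij.symm)
    simpa using this
  have hnot : s(i, j) ∉ (parentGraph c fun _ => c).edgeSet := by
    rw [SimpleGraph.mem_edgeSet, parentGraph, SimpleGraph.fromRel_adj]
    tauto
  have hsub : insert s(i, j) (parentGraph c fun _ => c).edgeSet ⊆ H.unionJoinGraph.edgeSet := by
    refine Set.insert_subset hmem (SimpleGraph.edgeSet_mono fun a b hab => ?_)
    exact ⟨_, isJoinTree_star hc, hab⟩
  have hle := Set.ncard_le_ncard hsub (Set.toFinite _)
  rw [Set.ncard_insert_of_notMem hnot (Set.toFinite _)] at hle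
  have := ((SimpleGraph.isTree_iff_connected_and_card).1 (isJoinTree_star hc).1).2
  rw [Nat.card_coe_set_eq, Nat.card_eq_fintype_card, Fintype.card_fin] at this
  omega

/-- A hypergraph with a vertex in all hyperedges is a hypertree. -/
theorem isHypertree_of_universal {u : Fin H.n} (hu : ∀ i, u ∈ H.edge i) : H.IsHypertree :=
  ⟨parentGraph u fun _ => u, parentGraph_isTree_of_depth_le_two fun _ hx => ⟨hx.symm, rfl⟩,
    fun i => parentGraph_induce_preconnected (fun _ hx => ⟨hx.symm, rfl⟩) (by simpa using hu i)
      fun _ _ => by simpa using hu i⟩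

theorem incidenceGraph_connected {u : Fin H.n} (hu : ∀ i, u ∈ H.edge i)
    (hc : ∀ v, v ∈ H.edge c) : H.incidenceGraph.Connected := by
  have hadj : ∀ v i, v ∈ H.edge i → H.incidenceGraph.Adj (.inl v) (.inr i) := by
    intro v i hv
    rw [incidenceGraph, SimpleGraph.fromRel_adj]
    exact ⟨by simp, .inl ⟨v, i, rfl, rfl, hv⟩⟩
  have hreach : ∀ x, H.incidenceGraph.Reachable x (.inl u) := by
    rintro (v | i)
    · exact (hadj v c (hc v)).reachable.trans (hadj u c (hc u)).reachable.symm
    · exact (hadj u i (hu i)).reachable.symm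
  have : Nonempty (Fin H.n ⊕ Fin H.m) := ⟨.inl u⟩
  exact ⟨fun x y => (hreach x).trans (hreach y).symm⟩

end FinHypergraph

/-- Each edge is listed once and takes two entries. So the length of the output already reveals the
number of edges, and the list itself never has to be inspected. -/
theorem IsEdgeList.length_eq {m : ℕ} {G : SimpleGraph (Fin m)} {l : List ℕ}
    (h : IsEdgeList G l) : l.length = 2 * G.edgeSet.ncard := by
  classical
  obtain ⟨es, rfl, hnd, hmem⟩ := h
  have : G.edgeSet = ((es.map fun e => s(e.1, e.2)).toFinset : Set (Sym2 (Fin m))) := by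
    ext e
    rw [← hmem]
    simp
  rw [this, Set.ncard_coe_finset, List.toFinset_card_of_nodup hnd]
  simp [List.length_flatMap, mul_comm]

/-! ### The hypergraph of a formula

The variables are split into two halves of `h` variables each.  For each assignment of the first half
and each assignment of the second half there is a hyperedge, and there is one hyperedge with all
vertices.  The vertices are the literals, the clauses, and a vertex that lies in all hyperedges.
The hyperedge of an assignment of the first half consists of its true literals and the clauses that
it does not satisfy; the hyperedge of an assignment of the second half consists of its true literals,
the clauses that it satisfies, and all literals of the first half.  Hence the former is contained in
the latter if and only if the two assignments together satisfy the formula, and all other pairs of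
these hyperedges are incomparable. -/

namespace CNFFormula

/-- The number `h` of variables in each half. -/
def half (φ : CNFFormula) : ℕ := φ.numVars / 2 + 1

/-- The literal with code `l` belongs to half `t` and is true under its assignment `a`. -/
def litTrue (h t a l : ℕ) : Bool :=
  decide (2 * h * t ≤ l) && decide (l < 2 * h * t + 2 * h) &&
    decide (a / 2 ^ ((l - 2 * h * t) / 2) % 2 = l % 2)

/-- Some literal of a clause belongs to half `t` and is true under its assignment `a`. -/
def clauseTrue {n : ℕ} (h t a : ℕ) (c : List (Fin n × Bool)) : Bool :=
  c.any fun l => litTrue h t a (2 * (l.1 : ℕ) + l.2.toNat)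

/-- The vertex `v` lies in the hyperedge `i`. -/
def inEdge (φ : CNFFormula) (i v : ℕ) : Bool :=
  if v < 4 * φ.half then
    decide (v < 2 * φ.half * (i / 2 ^ φ.half)) ||
      litTrue φ.half (i / 2 ^ φ.half) (i % 2 ^ φ.half) v
  else
    match φ.clauses[v - 4 * φ.half]? with
    | some c => ((clauseTrue φ.half (i / 2 ^ φ.half) (i % 2 ^ φ.half) c).toNat + 1 +
        i / 2 ^ φ.half) % 2 == 1
    | none => true

/-- The number of vertices. -/
def vertexCount (φ : CNFFormula) : ℕ := 4 * φ.half + φ.clauses.length + 1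

/-- The number of hyperedges. -/
def edgeCount (φ : CNFFormula) : ℕ := 2 * 2 ^ φ.half + 1

theorem inEdge_last (φ : CNFFormula) (i : ℕ) :
    φ.inEdge i (4 * φ.half + φ.clauses.length) = true := by
  simp [inEdge]

/-- The hypergraph of a formula. -/
def hypergraph (φ : CNFFormula) : FinHypergraph where
  n := φ.vertexCount
  m := φ.edgeCount
  edge i := Finset.univ.filter fun v => φ.inEdge i v = true
  edge_nonempty i := ⟨⟨4 * φ.half + φ.clauses.length, Nat.lt_succ_self _⟩, by
    simp [inEdge_last]⟩

/-- Translates the arithmetic with quotients and remainders, which the machine performs, into a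
statement about the bits of the assignment. -/
theorem litTrue_iff {h t a x : ℕ} {b : Bool} : litTrue h t a (2 * x + b.toNat) = true ↔
    h * t ≤ x ∧ x < h * t + h ∧ a.testBit (x - h * t) = b := by
  have hb := b.toNat_lt
  have h₁ : (2 * x + b.toNat - 2 * (h * t)) / 2 = x - h * t := by omega
  have h₂ : (2 * x + b.toNat) % 2 = b.toNat := by omega
  simp only [litTrue, Bool.and_eq_true, decide_eq_true_eq, mul_assoc, h₁, h₂,
    Nat.testBit_eq_decide_div_mod_eq]
  have h₃ : a / 2 ^ (x - h * t) % 2 < 2 := Nat.mod_lt _ two_pos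
  rw [show (2 * (h * t) ≤ 2 * x + b.toNat ↔ h * t ≤ x) by omega,
    show (2 * x + b.toNat < 2 * (h * t) + 2 * h ↔ x < h * t + h) by omega, and_assoc]
  refine and_congr_right fun _ => and_congr_right fun _ => ?_
  cases b <;> simp

/-! ### Containment of hyperedges and satisfiability -/

variable (φ : CNFFormula)

theorem clauseTrue_iff {n h t a : ℕ} {c : List (Fin n × Bool)} : clauseTrue h t a c = true ↔
    ∃ l ∈ c, h * t ≤ l.1 ∧ (l.1 : ℕ) < h * t + h ∧ a.testBit (l.1 - h * t) = l.2 := by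
  simp [clauseTrue, litTrue_iff]

theorem inEdge_literal {t a x : ℕ} {b : Bool} (ha : a < 2 ^ φ.half) (hx : x < 2 * φ.half) :
    φ.inEdge (t * 2 ^ φ.half + a) (2 * x + b.toNat) = true ↔ x < φ.half * t ∨
      (φ.half * t ≤ x ∧ x < φ.half * t + φ.half ∧ a.testBit (x - φ.half * t) = b) := by
  have hb := b.toNat_lt
  have hd : (t * 2 ^ φ.half + a) / 2 ^ φ.half = t := by
    rw [mul_comm, Nat.mul_add_div (by positivity), Nat.div_eq_of_lt ha, add_zero]
  have hm : (t * 2 ^ φ.half + a) % 2 ^ φ.half = a := by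
    rw [mul_comm, Nat.mul_add_mod, Nat.mod_eq_of_lt ha]
  rw [inEdge, if_pos (by omega), hd, hm, Bool.or_eq_true, litTrue_iff, decide_eq_true_eq,
    mul_assoc, show (2 * x + b.toNat < 2 * (φ.half * t) ↔ x < φ.half * t) by omega]

theorem inEdge_clause {t a k : ℕ} (ha : a < 2 ^ φ.half) (hk : k < φ.clauses.length) :
    φ.inEdge (t * 2 ^ φ.half + a) (4 * φ.half + k) =
      (((clauseTrue φ.half t a φ.clauses[k]).toNat + 1 + t) % 2 == 1) := by
  have hd : (t * 2 ^ φ.half + a) / 2 ^ φ.half = t := by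
    rw [mul_comm, Nat.mul_add_div (by positivity), Nat.div_eq_of_lt ha, add_zero]
  have hm : (t * 2 ^ φ.half + a) % 2 ^ φ.half = a := by
    rw [mul_comm, Nat.mul_add_mod, Nat.mod_eq_of_lt ha]
  rw [inEdge, if_neg (by omega), hd, hm]
  simp [hk]

/-- Every vertex is a literal, a clause, or the last vertex. -/
theorem vertex_cases {P : ℕ → Prop} (hlit : ∀ x (b : Bool), x < 2 * φ.half → P (2 * x + b.toNat))
    (hcl : ∀ k < φ.clauses.length, P (4 * φ.half + k))
    (hlast : P (4 * φ.half + φ.clauses.length)) {v : ℕ} (hv : v < φ.vertexCount) : P v := by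
  rw [vertexCount] at hv
  by_cases h₁ : v < 4 * φ.half
  · have := hlit (v / 2) (decide (v % 2 = 1)) (by omega)
    rwa [show 2 * (v / 2) + (decide (v % 2 = 1)).toNat = v by
      rcases Nat.mod_two_eq_zero_or_one v with h | h <;> simp [h] <;> omega] at this
  · by_cases h₂ : v < 4 * φ.half + φ.clauses.length
    · have := hcl (v - 4 * φ.half) (by omega)
      rwa [show 4 * φ.half + (v - 4 * φ.half) = v by omega] at this
    · rwa [show v = 4 * φ.half + φ.clauses.length by omega]

/-- The hyperedge with all vertices. -/
def centre : Fin φ.hypergraph.m := ⟨2 * 2 ^ φ.half, Nat.lt_succ_self _⟩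

theorem mem_edge {i : Fin φ.hypergraph.m} {v : Fin φ.hypergraph.n} :
    v ∈ φ.hypergraph.edge i ↔ φ.inEdge i v = true :=
  Finset.mem_filter.trans (and_iff_right (Finset.mem_univ _))

/-- The centre has the index of "half 2, assignment 0". All literals precede this fictitious half,
and no clause has a literal in it, so the parity in `inEdge` is that of `0 + 1 + 2`. Thus the
uniform definition of `inEdge` needs no special case. -/
theorem mem_edge_centre (v : Fin φ.hypergraph.n) : v ∈ φ.hypergraph.edge φ.centre := by
  rw [mem_edge]
  have h0 : 0 < 2 ^ φ.half := by positivity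
  refine φ.vertex_cases (P := fun v => φ.inEdge (2 * 2 ^ φ.half) v = true) ?_ ?_
    (inEdge_last _ _) v.2
  · intro x b hx
    have := φ.inEdge_literal (t := 2) (a := 0) (b := b) h0 hx
    rw [add_zero] at this
    exact this.2 (.inl (by omega))
  · intro k hk
    have := φ.inEdge_clause (t := 2) (a := 0) h0 hk
    rw [add_zero] at this
    have hf : clauseTrue φ.half 2 0 φ.clauses[k] = false := by
      refine Bool.eq_false_iff.2 fun h => ?_
      obtain ⟨l, -, h, -⟩ := clauseTrue_iff.1 h
      have := l.1.2
      rw [half] at h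
      omega
    rw [this, hf]
    rfl

theorem last_mem_edge (i : Fin φ.hypergraph.m) :
    (⟨4 * φ.half + φ.clauses.length, Nat.lt_succ_self _⟩ : Fin φ.hypergraph.n) ∈
      φ.hypergraph.edge i := by
  rw [mem_edge, inEdge_last]

theorem edge_subset_iff {i j : Fin φ.hypergraph.m} :
    φ.hypergraph.edge i ⊆ φ.hypergraph.edge j ↔
      ∀ v < φ.vertexCount, φ.inEdge i v = true → φ.inEdge j v = true := by
  constructor
  · intro h v hv hi
    exact φ.mem_edge.1 (h (φ.mem_edge.2 hi : (⟨v, hv⟩ : Fin φ.hypergraph.n) ∈ _))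
  · intro h v hi
    exact φ.mem_edge.2 (h v v.2 (φ.mem_edge.1 hi))

/-- Hyperedges other than the centre are given by a half and an assignment of it. -/
theorem exists_eq_of_ne_centre {i : Fin φ.hypergraph.m} (hi : i ≠ φ.centre) :
    ∃ t < 2, ∃ a < 2 ^ φ.half, (i : ℕ) = t * 2 ^ φ.half + a := by
  have h₁ : (i : ℕ) < 2 * 2 ^ φ.half := by
    have h₁ : (i : ℕ) < 2 * 2 ^ φ.half + 1 := i.2
    have h₂ : (i : ℕ) ≠ 2 * 2 ^ φ.half := fun h => hi (Fin.ext h)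
    omega
  exact ⟨i / 2 ^ φ.half, Nat.div_lt_of_lt_mul (by rwa [mul_comm]), i % 2 ^ φ.half,
    Nat.mod_lt _ (by positivity), (Nat.div_add_mod' _ _).symm⟩

/-- The literal vertices rule out every containment except that of a hyperedge of the first half in
one of the second half. Then a clause not satisfied by the first assignment is a vertex of the
smaller hyperedge, hence of the larger one, hence satisfied by the second assignment. -/
theorem satisfiable_of_subset {i j : Fin φ.hypergraph.m} (hi : i ≠ φ.centre) (hj : j ≠ φ.centre)
    (hij : i ≠ j) (hsub : φ.hypergraph.edge i ⊆ φ.hypergraph.edge j) : φ.Satisfiable := by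
  rw [edge_subset_iff] at hsub
  obtain ⟨t, ht, a, ha, hit⟩ := φ.exists_eq_of_ne_centre hi
  obtain ⟨t', ht', b, hb, hjt⟩ := φ.exists_eq_of_ne_centre hj
  have hhalf : 0 < φ.half := Nat.succ_pos _
  have hlit : ∀ x (β : Bool), x < 2 * φ.half → _ := fun x β hx hx' =>
    (φ.inEdge_literal (b := β) hb hx).1 (hjt ▸ hsub (2 * x + β.toNat)
      (by have := β.toNat_lt; rw [vertexCount]; omega)
      (hit ▸ (φ.inEdge_literal (b := β) ha hx).2 hx'))
  have hne : t * 2 ^ φ.half + a ≠ t' * 2 ^ φ.half + b := by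
    rw [← hit, ← hjt]
    exact fun h => hij (Fin.ext h)
  -- At a bit where two assignments of the same half differ, the literal true under `a` lies in the
  -- first hyperedge only.
  have hsame : t ≠ t' := by
    rintro rfl
    have hab : a ≠ b := fun h => hne (by rw [h])
    obtain ⟨x, hx⟩ := Nat.exists_testBit_ne_of_ne hab
    have hxh : x < φ.half := by
      by_contra! h
      have h2 := Nat.pow_le_pow_right two_pos h
      exact hx (by rw [Nat.testBit_lt_two_pow (ha.trans_le h2),
        Nat.testBit_lt_two_pow (hb.trans_le h2)])
    have hle : φ.half * t ≤ φ.half * 1 := by gcongr; omega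
    rcases hlit (φ.half * t + x) (a.testBit x) (by omega)
      (.inr ⟨by omega, by omega, by simp⟩) with h | ⟨-, -, h⟩
    · omega
    · simp only [Nat.add_sub_cancel_left] at h
      exact hx h.symm
  -- A hyperedge of the second half contains a literal of the first variable of that half, and a
  -- hyperedge of the first half does not. The variable exists because `half` is positive even
  -- without any variables in the formula.
  obtain ⟨rfl, rfl⟩ : t = 0 ∧ t' = 1 := by
    by_contra h
    obtain ⟨rfl, rfl⟩ : t = 1 ∧ t' = 0 := by omega
    rcases hlit φ.half (a.testBit 0) (by omega) (.inr ⟨by omega, by omega, by simp⟩) with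
      h | ⟨-, h, -⟩ <;> omega
  refine ⟨fun x => if (x : ℕ) < φ.half then a.testBit x else b.testBit (x - φ.half), fun c hc => ?_⟩
  obtain ⟨k, hk, rfl⟩ := List.getElem_of_mem hc
  by_cases hca : clauseTrue φ.half 0 a φ.clauses[k] = true
  · obtain ⟨l, hl, -, h₁, h₂⟩ := clauseTrue_iff.1 hca
    refine ⟨l, hl, ?_⟩
    have h₃ : (l.1 : ℕ) < φ.half := by omega
    simp [h₃, ← h₂]
  · have h₁ := hsub (4 * φ.half + k) (by rw [vertexCount]; omega)
    rw [hit, hjt, φ.inEdge_clause ha hk, φ.inEdge_clause hb hk, Bool.eq_false_iff.2 hca] at h₁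
    have hcb : clauseTrue φ.half 1 b φ.clauses[k] = true := by
      cases h : clauseTrue φ.half 1 b φ.clauses[k] <;> simp [h] at h₁ ⊢
    obtain ⟨l, hl, h₁, -, h₂⟩ := clauseTrue_iff.1 hcb
    refine ⟨l, hl, ?_⟩
    have h₃ : ¬ (l.1 : ℕ) < φ.half := by omega
    simp [h₃, ← h₂]

/-- Cut a satisfying assignment into two bit strings. A clause vertex of the first hyperedge is not
satisfied by the first part, so the true literal of the clause belongs to the second half. -/
theorem Satisfiable.exists_subset {φ : CNFFormula} (h : φ.Satisfiable) :
    ∃ i j, i ≠ φ.centre ∧ j ≠ φ.centre ∧ i ≠ j ∧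
      φ.hypergraph.edge i ⊆ φ.hypergraph.edge j := by
  obtain ⟨σ, hσ⟩ := h
  -- Since `numVars < 2 * half`, the halves contain padding variables; they occur in no clause and
  -- are set to `false`.
  let g : ℕ → Bool := fun x => if hx : x < φ.numVars then σ ⟨x, hx⟩ else false
  let a := Nat.ofBits fun x : Fin φ.half => g x
  let b := Nat.ofBits fun x : Fin φ.half => g (φ.half + x)
  have ha : a < 2 ^ φ.half := Nat.ofBits_lt_two_pow _
  have hb : b < 2 ^ φ.half := Nat.ofBits_lt_two_pow _
  refine ⟨⟨0 * 2 ^ φ.half + a, ?_⟩, ⟨1 * 2 ^ φ.half + b, ?_⟩, fun h => ?_, fun h => ?_,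
    fun h => ?_, ?_⟩
  · show _ < 2 * 2 ^ φ.half + 1
    omega
  · show _ < 2 * 2 ^ φ.half + 1
    omega
  · have : 0 * 2 ^ φ.half + a = 2 * 2 ^ φ.half := congrArg Fin.val h
    omega
  · have : 1 * 2 ^ φ.half + b = 2 * 2 ^ φ.half := congrArg Fin.val h
    omega
  · have : 0 * 2 ^ φ.half + a = 1 * 2 ^ φ.half + b := congrArg Fin.val h
    omega
  · rw [edge_subset_iff]
    intro v hv
    refine φ.vertex_cases (P := fun v => φ.inEdge (0 * 2 ^ φ.half + a) v = true →
      φ.inEdge (1 * 2 ^ φ.half + b) v = true) ?_ ?_ (fun _ => inEdge_last _ _) hv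
    · intro x β hx
      rw [φ.inEdge_literal ha hx, φ.inEdge_literal hb hx]
      omega
    · intro k hk
      rw [φ.inEdge_clause ha hk, φ.inEdge_clause hb hk]
      intro h
      obtain ⟨l, hl, hσl⟩ := hσ _ (List.getElem_mem hk)
      have hg : g l.1 = l.2 := by simp [g, hσl]
      have hl2 : (l.1 : ℕ) < 2 * φ.half := by
        have := l.1.2
        rw [half]
        omega
      by_cases hlt : (l.1 : ℕ) < φ.half
      · have : clauseTrue φ.half 0 a φ.clauses[k] = true :=
          clauseTrue_iff.2 ⟨l, hl, by omega, by omega, by simp [a, hlt, hg]⟩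
        simp [this] at h
      · have : clauseTrue φ.half 1 b φ.clauses[k] = true := by
          refine clauseTrue_iff.2 ⟨l, hl, by omega, by omega, ?_⟩
          have h₁ : (l.1 : ℕ) - φ.half < φ.half := by omega
          have h₂ : φ.half + ((l.1 : ℕ) - φ.half) = l.1 := by omega
          simp [b, h₁, h₂, hg]
        simp [this]

theorem hypergraph_isAcyclic : φ.hypergraph.IsAcyclic :=
  ⟨_, FinHypergraph.isJoinTree_star φ.mem_edge_centre⟩

theorem hypergraph_isHypertree : φ.hypergraph.IsHypertree :=
  FinHypergraph.isHypertree_of_universal φ.last_mem_edge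

theorem hypergraph_connected : φ.hypergraph.incidenceGraph.Connected :=
  FinHypergraph.incidenceGraph_connected φ.last_mem_edge φ.mem_edge_centre

theorem ncard_edgeSet_of_not_satisfiable (h : ¬ φ.Satisfiable) :
    φ.hypergraph.unionJoinGraph.edgeSet.ncard + 1 = φ.edgeCount :=
  FinHypergraph.ncard_edgeSet_unionJoinGraph φ.mem_edge_centre fun _ _ hi hj hij hsub =>
    h (φ.satisfiable_of_subset hi hj hij hsub)

variable {φ} in
theorem Satisfiable.edgeCount_le_ncard_edgeSet (h : φ.Satisfiable) :
    φ.edgeCount ≤ φ.hypergraph.unionJoinGraph.edgeSet.ncard := by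
  obtain ⟨i, j, hi, hj, hij, hsub⟩ := h.exists_subset
  exact FinHypergraph.le_ncard_edgeSet_unionJoinGraph φ.mem_edge_centre hi hj hij hsub

/-! ### Encoding and size of the hypergraph -/

/-- The vertices of a hyperedge in increasing order. -/
def row (i : ℕ) : List ℕ := (List.range φ.vertexCount).filter (φ.inEdge i)

theorem map_val_filter_finRange {n : ℕ} (p : ℕ → Bool) :
    ((List.finRange n).filter fun v : Fin n => p v).map Fin.val = (List.range n).filter p := by
  rw [← List.map_coe_finRange_eq_range, List.filter_map]
  rfl

theorem card_edge (i : Fin φ.hypergraph.m) : (φ.hypergraph.edge i).card = (φ.row i).length := by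
  have h : φ.hypergraph.edge i = ((List.finRange φ.hypergraph.n).filter
      fun v : Fin φ.hypergraph.n => φ.inEdge i v).toFinset := by
    ext v
    simp [mem_edge]
  rw [h, List.toFinset_card_of_nodup ((List.nodup_finRange _).filter _),
    ← List.length_map Fin.val, map_val_filter_finRange]
  rfl

theorem encode_hypergraph : φ.hypergraph.encode = φ.vertexCount :: φ.edgeCount ::
    (List.range φ.edgeCount).flatMap fun i => (φ.row i).length :: φ.row i := by
  have h : ∀ i : Fin φ.hypergraph.m, ((List.finRange φ.hypergraph.n).filter
      (· ∈ φ.hypergraph.edge i)).map Fin.val = φ.row i := by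
    intro i
    rw [row, ← map_val_filter_finRange]
    refine congrArg (List.map Fin.val) (List.filter_congr fun v _ => ?_)
    rw [Bool.eq_iff_iff, decide_eq_true_iff, mem_edge]
  rw [FinHypergraph.encode]
  simp only [h, card_edge]
  rw [← List.map_coe_finRange_eq_range, List.flatMap_map]
  rfl

theorem totalSize_eq : φ.hypergraph.totalSize =
    ∑ i ∈ Finset.range φ.edgeCount, (φ.row i).length := by
  rw [FinHypergraph.totalSize, Finset.sum_range]
  exact Finset.sum_congr rfl fun i _ => φ.card_edge i

/-- Two entries for the header, one per hyperedge for its cardinality, one per incidence. So `setup`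
obtains `N` from the length of the code by two subtractions. -/
theorem length_encode_hypergraph :
    φ.hypergraph.encode.length = 2 + φ.edgeCount + φ.hypergraph.totalSize := by
  rw [encode_hypergraph, totalSize_eq, Finset.sum_range, Fin.sum_univ_def]
  simp only [List.length_cons, List.length_flatMap]
  rw [← List.map_coe_finRange_eq_range, List.map_map, show
    ((fun i => (φ.row i).length + 1) ∘ Fin.val : Fin φ.edgeCount → ℕ) =
      fun i : Fin φ.edgeCount => (φ.row i).length + 1 from rfl, List.sum_map_add]
  simp only [List.map_const', List.sum_replicate, List.length_finRange, smul_eq_mul]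
  omega

theorem length_row_le (i : ℕ) : (φ.row i).length ≤ φ.vertexCount :=
  (List.length_filter_le _ _).trans (by simp)

theorem totalSize_le : φ.hypergraph.totalSize ≤ φ.edgeCount * φ.vertexCount := by
  rw [totalSize_eq]
  refine (Finset.sum_le_card_nsmul _ _ φ.vertexCount fun i _ => φ.length_row_le i).trans ?_
  simp

theorem edgeCount_le_totalSize : φ.edgeCount ≤ φ.hypergraph.totalSize := by
  have := Finset.card_nsmul_le_sum Finset.univ (fun i => (φ.hypergraph.edge i).card) 1
    fun i _ => Finset.card_pos.2 (φ.hypergraph.edge_nonempty i)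
  rw [Finset.card_univ, Fintype.card_fin, smul_eq_mul, mul_one] at this
  exact this

end CNFFormula

/-! ### The program that writes the hypergraph of a formula -/

namespace RAM

/-- holds the number `2` -/
notation "rTwo" => 2
notation "rVars" => 3
notation "rClauses" => 4
notation "rHalf" => 5
/-- number of assignments of a half -/
notation "rPow" => 6
/-- number of literals of a half -/
notation "rPart" => 7
/-- number of all literals -/
notation "rLits" => 8
notation "rVerts" => 9
notation "rEdges" => 10
/-- first memory cell behind the output -/
notation "rOut" => 12
/-- current hyperedge -/
notation "rEdge" => 13
/-- half of the current hyperedge -/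
notation "rType" => 14
/-- assignment of the current hyperedge -/
notation "rAssign" => 15
/-- current vertex -/
notation "rVert" => 16
/-- memory cell of the cardinality of the current hyperedge -/
notation "rCard" => 17
/-- position in the formula -/
notation "rPos" => 18
notation "rAcc" => 19
/-- current literal -/
notation "rLit" => 20
/-- result of a test -/
notation "rBit" => 21
notation "rCountA" => 22
notation "rCountB" => 23
notation "rCountC" => 24
notation "rCountD" => 25
notation "rTemp" => 26
notation "rTest" => 27
/-- number of literals before the half of the current hyperedge -/
notation "rSkip" => 28

namespace Prog

/-- Test whether the literal `rLit` is true. -/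
def testLit : Prog :=
  .const rBit 0 ;; .op .sub rTemp rSkip rLit ;; .ite rTemp .skip
    (.op .sub rTemp rLit rSkip ;; .op .sub rTest rPart rTemp ;; .ite rTest
      (.op .div rCountD rTemp rTwo ;; .copy rTemp rAssign ;;
        .repeat rCountD (.op .div rTemp rTemp rTwo) ;;
        .op .mod rTemp rTemp rTwo ;; .op .mod rTest rLit rTwo ;; .op .xor rTemp rTemp rTest ;;
        .op .sub rBit rOne rTemp)
      .skip)

/-- Append the current vertex to the output if the test was positive, and go to the next vertex. -/
def emit : Prog :=
  .ite rBit (.store rOut rVert ;; .op .add rOut rOut rOne) .skip ;; .op .add rVert rVert rOne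

/-- Truncated subtraction serves as comparison: `rSkip - rLit` is nonzero exactly for the literals
before the current half, which lie in the hyperedge whatever the assignment. -/
def literalStep : Prog :=
  .copy rLit rVert ;; testLit ;; .op .sub rTemp rSkip rLit ;;
    .ite rTemp (.const rBit 1) .skip ;; emit

def clauseLitStep : Prog :=
  .load rLit rPos ;; testLit ;; .op .lor rAcc rAcc rBit ;; .op .add rPos rPos rOne

/-- `rAcc` collects the disjunction of the literal tests; the subsequent additions and the remainder
compute the parity from `inEdge`. -/
def clauseStep : Prog :=
  .const rAcc 0 ;; .load rCountC rPos ;; .op .add rPos rPos rOne ;;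
    .repeat rCountC clauseLitStep ;;
    .op .add rBit rAcc rOne ;; .op .add rBit rBit rType ;; .op .mod rBit rBit rTwo ;; emit

/-- Append the current hyperedge to the output, and go to the next one. -/
def edgeStep : Prog :=
  .op .div rType rEdge rPow ;; .op .mod rAssign rEdge rPow ;; .op .mul rSkip rPart rType ;;
    .copy rCard rOut ;; .op .add rOut rOut rOne ;; .const rVert 0 ;;
    .copy rCountB rLits ;; .repeat rCountB literalStep ;;
    .const rPos 2 ;; .copy rCountB rClauses ;; .repeat rCountB clauseStep ;;
    .const rBit 1 ;; emit ;;
    .op .sub rTemp rOut rCard ;; .op .sub rTemp rTemp rOne ;; .store rCard rTemp ;;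
    .op .add rEdge rEdge rOne

/-- Read the formula and set up the parameters of the hypergraph. -/
def readFormula : Prog :=
  .copy rBase 0 ;; .const rOne 1 ;; .const rTwo 2 ;; .load rVars rTemp ;;
    .load rClauses rOne ;; .op .div rHalf rVars rTwo ;; .op .add rHalf rHalf rOne ;;
    .const rPow 1 ;; .copy rCountA rHalf ;; .repeat rCountA (.op .mul rPow rPow rTwo) ;;
    .op .mul rPart rTwo rHalf ;; .op .mul rLits rTwo rPart ;;
    .op .add rVerts rLits rClauses ;; .op .add rVerts rVerts rOne ;;
    .op .mul rEdges rTwo rPow ;; .op .add rEdges rEdges rOne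

/-- Write the hypergraph of the formula into the memory behind the formula. -/
def writeHypergraph : Prog :=
  readFormula ;;
    .copy rOut rBase ;; .store rOut rVerts ;; .op .add rOut rOut rOne ;; .store rOut rEdges ;;
    .op .add rOut rOut rOne ;; .const rEdge 0 ;; .copy rCountA rEdges ;;
    .repeat rCountA edgeStep

end Prog

/-- A memory that holds a list from cell `0` on. -/
def memOf (l : List ℕ) (x : ℕ) : ℕ := l.getD x 0

theorem update_memOf_append (l : List ℕ) (x : ℕ) :
    Function.update (memOf l) l.length x = memOf (l ++ [x]) := by
  ext y
  rcases lt_trichotomy y l.length with h | rfl | h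
  · rw [Function.update_apply, if_neg h.ne, memOf, memOf, List.getD_append _ _ _ _ h]
  · simp [memOf]
  · rw [Function.update_apply, if_neg h.ne', memOf, memOf, List.getD_eq_default _ _ h.le,
      List.getD_eq_default _ _ (by simpa using h)]

/-- Cells behind a list read as `0`, so a cell may be reserved without writing to it. In this way
`edgeStep` leaves room for a cardinality, which it fills in later by `update_memOf_middle`. -/
theorem memOf_append_zero (l : List ℕ) : memOf (l ++ [0]) = memOf l := by
  rw [← update_memOf_append]
  simp [memOf]

theorem update_memOf_middle (l l' : List ℕ) (x y : ℕ) :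
    Function.update (memOf (l ++ y :: l')) l.length x = memOf (l ++ x :: l') := by
  ext z
  rcases lt_trichotomy z l.length with h | rfl | h
  · rw [Function.update_apply, if_neg h.ne, memOf, memOf, List.getD_append _ _ _ _ h,
      List.getD_append _ _ _ _ h]
  · simp [memOf]
  · obtain ⟨d, rfl⟩ : ∃ d, z = l.length + (d + 1) := ⟨z - l.length - 1, by omega⟩
    rw [Function.update_apply, if_neg h.ne', memOf, memOf,
      List.getD_append_right _ _ _ _ (by omega), List.getD_append_right _ _ _ _ (by omega)]
    simp

/-- The parameters of the hypergraph stand in their registers. -/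
structure Params (φ : CNFFormula) (s : State) : Prop where
  one : s.reg rOne = 1
  two : s.reg rTwo = 2
  vars : s.reg rVars = φ.numVars
  clauses : s.reg rClauses = φ.clauses.length
  pow : s.reg rPow = 2 ^ φ.half
  part : s.reg rPart = 2 * φ.half
  lits : s.reg rLits = 4 * φ.half
  verts : s.reg rVerts = φ.vertexCount
  edges : s.reg rEdges = φ.edgeCount
  base : s.reg rBase = φ.encode.length

theorem Params.congr {φ : CNFFormula} {s s' : State} (h : Params φ s)
    (hr : ∀ r < 12, s'.reg r = s.reg r) : Params φ s' where
  one := (hr _ (by norm_num)).trans h.one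
  two := (hr _ (by norm_num)).trans h.two
  vars := (hr _ (by norm_num)).trans h.vars
  clauses := (hr _ (by norm_num)).trans h.clauses
  pow := (hr _ (by norm_num)).trans h.pow
  part := (hr _ (by norm_num)).trans h.part
  lits := (hr _ (by norm_num)).trans h.lits
  verts := (hr _ (by norm_num)).trans h.verts
  edges := (hr _ (by norm_num)).trans h.edges
  base := (hr _ (by norm_num)).trans h.base

/-! ### Correctness and cost of the writing program -/

variable {W : ℕ} {s : State} {t₀ : ℕ} {Q : ℕ → State → Prop} {φ : CNFFormula}

open CNFFormula in
theorem wp_testLit {t a l : ℕ} (hP : Params φ s) (hskip : s.reg rSkip = 2 * φ.half * t)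
    (ha : s.reg rAssign = a) (hl : s.reg rLit = l) (haW : a ≤ W) (hlW : l ≤ W)
    (hskipW : 2 * φ.half * t ≤ W) (hpartW : 2 * φ.half ≤ W) :
    wp W .testLit s t₀ fun T s' => T ≤ t₀ + 3 * φ.half + 13 ∧ s'.mem = s.mem ∧
      s'.reg rBit = (litTrue φ.half t a l).toNat := by
  have h1 : 1 ≤ φ.half := Nat.succ_pos _
  simp only [Prog.testLit, wp_seq, wp_const, wp_op, wp_ite, wp_skip, wp_copy, Op.eval]
  simp [hskip, hl, hP.part, hP.two, ha]
  refine ⟨by omega, fun h => ⟨by omega, ?_⟩,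
    fun h => ⟨by omega, by omega, fun h' => ⟨by omega, by omega, ?_⟩, fun h' => ⟨by omega, ?_⟩⟩⟩
  · have : litTrue φ.half t a l = false := by
      have : ¬ 2 * φ.half * t ≤ l := by omega
      simp [litTrue, this]
    simp [this]
  -- The bit of the assignment is brought to the lowest position by repeated halving; its index is
  -- below `half`, whence the summand `3 * half` in the time.
  · refine wp_repeat (fun j s' => s'.mem = s.mem ∧ s'.reg rTemp = a / 2 ^ j) 1
      ((l - 2 * φ.half * t) / 2) rfl rfl (by norm_num) (by simp) (by simp [hP.one]) (by omega)
      (by simp) ?_ ?_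
    · rintro k hk s' ⟨hmem, htemp⟩ hfr
      rw [wp_op, htemp, hfr 2 rfl]
      simp [hP.two, Op.eval, hmem, Nat.div_div_eq_div_mul, pow_succ]
      exact (Nat.div_le_self _ _).trans haW
    · rintro T s' hT ⟨hmem, htemp⟩ hfr
      simp [htemp, hfr 2 rfl, hfr 1 rfl, hfr rLit rfl, hP.two, hP.one, hl, hmem]
      have h₁ : 2 * φ.half * t ≤ l := by omega
      have h₂ : l < 2 * φ.half * t + 2 * φ.half := by omega
      simp only [litTrue, h₁, h₂, decide_true, Bool.true_and]
      generalize a / 2 ^ ((l - 2 * φ.half * t) / 2) = y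
      refine ⟨by omega, by omega, ?_, by omega, by omega, ?_⟩ <;>
        rcases Nat.mod_two_eq_zero_or_one y with hy | hy <;>
        rcases Nat.mod_two_eq_zero_or_one l with hl | hl <;> simp [hy, hl] <;> omega
  · have : litTrue φ.half t a l = false := by
      have : ¬ l < 2 * φ.half * t + 2 * φ.half := by omega
      simp [litTrue, this]
    simp [this]

/-- The memory holds `l`, followed by the vertices before `v` that satisfy `p`. -/
structure Emitted (l : List ℕ) (p : ℕ → Bool) (v : ℕ) (s : State) : Prop where
  mem : s.mem = memOf (l ++ (List.range v).filter p)
  out : s.reg rOut = (l ++ (List.range v).filter p).length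
  vert : s.reg rVert = v

theorem Emitted.congr {l : List ℕ} {p : ℕ → Bool} {v : ℕ} {s' : State} (h : Emitted l p v s)
    (hm : s'.mem = s.mem) (ho : s'.reg rOut = s.reg rOut) (hv : s'.reg rVert = s.reg rVert) :
    Emitted l p v s' :=
  ⟨hm.trans h.mem, ho.trans h.out, hv.trans h.vert⟩

theorem Emitted.out_le {l : List ℕ} {p : ℕ → Bool} {v : ℕ} (h : Emitted l p v s) :
    s.reg rOut ≤ l.length + v := by
  have := List.length_filter_le p (List.range v)
  rw [h.out, List.length_append]
  rw [List.length_range] at this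
  omega

theorem wp_emit {l : List ℕ} {p : ℕ → Bool} {v : ℕ} (h : Emitted l p v s)
    (h1 : s.reg rOne = 1) (hb : s.reg rBit = (p v).toNat) (hW : l.length + v + 1 ≤ W) :
    wp W .emit s t₀ fun T s' => T ≤ t₀ + 4 ∧ Emitted l p (v + 1) s' := by
  have hout := h.out_le
  simp only [Prog.emit, wp_seq, wp_ite, wp_store, wp_op, wp_skip, Op.eval]
  simp [h1, hb, h.vert]
  refine ⟨fun hp => ⟨by omega, by omega, by omega, ?_⟩, fun hp => ⟨by omega, ?_⟩⟩
  · refine ⟨?_, ?_, by simp⟩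
    · simp only [State.setReg_mem, State.setMem_mem, h.out, h.mem, update_memOf_append]
      simp [List.range_succ, hp]
    · simp only [State.setReg_reg, State.setMem_reg, h.out]
      simp [List.range_succ, hp]
      omega
  · refine ⟨?_, ?_, by simp⟩
    · simp [h.mem, List.range_succ, hp]
    · simp [h.out, List.range_succ, hp]

/-- What does not change while a hyperedge is written. -/
structure EdgeParams (φ : CNFFormula) (i : ℕ) (s : State) : Prop extends Params φ s where
  type : s.reg rType = i / 2 ^ φ.half
  assign : s.reg rAssign = i % 2 ^ φ.half
  skip : s.reg rSkip = 2 * φ.half * (i / 2 ^ φ.half)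

theorem EdgeParams.congr {i : ℕ} {s' : State} (h : EdgeParams φ i s)
    (hr : ∀ r ∈ List.range 12 ++ [rType, rAssign, rSkip], s'.reg r = s.reg r) :
    EdgeParams φ i s' where
  toParams := h.toParams.congr fun r hr' => hr r (by simp; omega)
  type := (hr _ (by simp)).trans h.type
  assign := (hr _ (by simp)).trans h.assign
  skip := (hr _ (by simp)).trans h.skip

/-- A bound on the words that are written along with the hypergraph. -/
def writeBound (φ : CNFFormula) : ℕ :=
  φ.encode.length + φ.edgeCount * (φ.vertexCount + 1) + 4 * φ.vertexCount + 20

theorem writeBound_spec (hW : writeBound φ ≤ W) : φ.edgeCount + 20 ≤ W ∧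
    φ.encode.length + 2 * φ.vertexCount + 20 ≤ W ∧ 4 * φ.half + 1 ≤ φ.vertexCount ∧
    2 * 2 ^ φ.half ≤ φ.edgeCount ∧ 0 < 2 ^ φ.half ∧ φ.clauses.length ≤ φ.vertexCount ∧
    0 < φ.half := by
  rw [writeBound] at hW
  have : φ.edgeCount * 1 ≤ φ.edgeCount * (φ.vertexCount + 1) := by gcongr; omega
  have : 0 < 2 ^ φ.half := by positivity
  have : φ.vertexCount = 4 * φ.half + φ.clauses.length + 1 := rfl
  have : φ.edgeCount = 2 * 2 ^ φ.half + 1 := rfl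
  have : φ.half = φ.numVars / 2 + 1 := rfl
  omega

theorem type_spec {i : ℕ} (hi : i < φ.edgeCount) : i / 2 ^ φ.half ≤ 2 ∧
    2 * φ.half * (i / 2 ^ φ.half) ≤ 4 * φ.half ∧ i % 2 ^ φ.half < 2 ^ φ.half := by
  rw [CNFFormula.edgeCount] at hi
  have h0 : 0 < 2 ^ φ.half := by positivity
  have h : i / 2 ^ φ.half ≤ 2 := Nat.le_of_lt_succ (Nat.div_lt_of_lt_mul (by omega))
  have : 2 * φ.half * (i / 2 ^ φ.half) ≤ 2 * φ.half * 2 := by gcongr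
  exact ⟨h, by omega, Nat.mod_lt _ h0⟩

theorem inEdge_of_lt {i v : ℕ} (hv : v < 4 * φ.half) : φ.inEdge i v =
    (decide (v < 2 * φ.half * (i / 2 ^ φ.half)) ||
      CNFFormula.litTrue φ.half (i / 2 ^ φ.half) (i % 2 ^ φ.half) v) := by
  rw [CNFFormula.inEdge, if_pos hv]

theorem wp_literalStep {i v : ℕ} {l : List ℕ} (hE : EdgeParams φ i s)
    (h : Emitted l (φ.inEdge i) v s) (hi : i < φ.edgeCount) (hv : v < 4 * φ.half)
    (hl : l.length + φ.vertexCount ≤ W) (hW : writeBound φ ≤ W) :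
    wp W .literalStep s t₀ fun T s' => T ≤ t₀ + 3 * φ.half + 23 ∧
      Emitted l (φ.inEdge i) (v + 1) s' := by
  have hb := writeBound_spec hW
  have ht := type_spec hi
  simp only [Prog.literalStep, wp_seq, wp_copy, h.vert]
  refine ⟨by omega, ?_⟩
  refine (wp_testLit (t := i / 2 ^ φ.half) (a := i % 2 ^ φ.half) (l := v)
    (hE.toParams.congr ?_) (by simp [hE.skip]) (by simp [hE.assign]) (by simp) (by omega)
    (by omega) (by omega) (by omega)).frame.mono ?_
  · intro r hr
    simp
    omega
  rintro T s' ⟨⟨hT, hmem, hbit⟩, hfr⟩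
  simp only [wp_op, wp_ite, wp_const, wp_skip, Op.eval]
  simp [hfr rSkip rfl, hfr rLit rfl, hE.skip]
  refine ⟨by omega, fun hlt => ⟨by omega, ?_⟩, fun hlt => ?_⟩
  · refine (wp_emit (h.congr (by simp [hmem]) (by simp [hfr rOut rfl]) (by simp [hfr rVert rfl]))
      (by simp [hfr rOne rfl, hE.one]) ?_ (by omega)).mono fun T' s'' h' => ⟨by omega, h'.2⟩
    have : v < 2 * φ.half * (i / 2 ^ φ.half) := by omega
    simp [inEdge_of_lt hv, this]
  · refine (wp_emit (h.congr (by simp [hmem]) (by simp [hfr rOut rfl]) (by simp [hfr rVert rfl]))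
      (by simp [hfr rOne rfl, hE.one]) ?_ (by omega)).mono fun T' s'' h' => ⟨by omega, h'.2⟩
    have : ¬ v < 2 * φ.half * (i / 2 ^ φ.half) := by omega
    simp [inEdge_of_lt hv, this, hbit]

/-- The position of the clause `k` in the code of a formula. -/
def clausePos (φ : CNFFormula) (k : ℕ) : ℕ :=
  2 + ((φ.clauses.take k).map fun c => c.length + 1).sum

theorem clausePos_succ {k : ℕ} (hk : k < φ.clauses.length) :
    clausePos φ (k + 1) = clausePos φ k + φ.clauses[k].length + 1 := by
  rw [clausePos, clausePos, List.take_add_one, List.getElem?_eq_getElem hk, List.map_append,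
    List.sum_append, Option.toList_some, List.map_singleton, List.sum_singleton]
  omega

theorem encode_eq {k : ℕ} (hk : k < φ.clauses.length) : ∃ l₁ l₂, l₁.length = clausePos φ k ∧
    φ.encode = l₁ ++ (φ.clauses[k].length ::
      φ.clauses[k].map fun l => 2 * (l.1 : ℕ) + l.2.toNat) ++ l₂ := by
  refine ⟨φ.numVars :: φ.clauses.length :: (φ.clauses.take k).flatMap fun c =>
      c.length :: c.map fun l => 2 * (l.1 : ℕ) + l.2.toNat,
    (φ.clauses.drop (k + 1)).flatMap fun c =>
      c.length :: c.map fun l => 2 * (l.1 : ℕ) + l.2.toNat, ?_, ?_⟩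
  · simp [clausePos, List.length_flatMap]
    omega
  · have h : φ.clauses = φ.clauses.take k ++ φ.clauses[k] :: φ.clauses.drop (k + 1) := by
      rw [List.getElem_cons_drop hk, List.take_append_drop]
    have h' := congrArg (List.flatMap fun c =>
      c.length :: c.map fun l => 2 * (l.1 : ℕ) + l.2.toNat) h
    rw [List.flatMap_append, List.flatMap_cons] at h'
    rw [CNFFormula.encode, h']
    simp only [List.cons_append, List.append_assoc]

theorem encode_clausePos {k : ℕ} (hk : k < φ.clauses.length) (l : List ℕ) :
    memOf (φ.encode ++ l) (clausePos φ k) = φ.clauses[k].length ∧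
      clausePos φ k + φ.clauses[k].length < φ.encode.length := by
  obtain ⟨l₁, l₂, h, he⟩ := encode_eq hk
  rw [he, ← h]
  constructor
  · simp [memOf]
  · simp

theorem encode_literal {k j : ℕ} (hk : k < φ.clauses.length) (hj : j < φ.clauses[k].length)
    (l : List ℕ) : memOf (φ.encode ++ l) (clausePos φ k + 1 + j) =
      2 * (φ.clauses[k][j].1 : ℕ) + φ.clauses[k][j].2.toNat := by
  obtain ⟨l₁, l₂, h, he⟩ := encode_eq hk
  rw [he, ← h, memOf, List.append_assoc, List.append_assoc,
    List.getD_append_right _ _ _ _ (by omega)]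
  rw [show l₁.length + 1 + j - l₁.length = j + 1 by omega, List.cons_append, List.getD_cons_succ,
    List.getD_append _ _ _ _ (by simpa using hj)]
  simp [hj]

open CNFFormula in
theorem wp_clauseLitStep {i k j : ℕ} {l : List ℕ} (hE : EdgeParams φ i s) (hi : i < φ.edgeCount)
    (hk : k < φ.clauses.length) (hj : j < φ.clauses[k].length) (hW : writeBound φ ≤ W)
    (hmem : s.mem = memOf (φ.encode ++ l)) (hpos : s.reg rPos = clausePos φ k + 1 + j)
    (hacc : s.reg rAcc = (clauseTrue φ.half (i / 2 ^ φ.half) (i % 2 ^ φ.half)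
      (φ.clauses[k].take j)).toNat) :
    wp W .clauseLitStep s t₀ fun T s' => T ≤ t₀ + 3 * φ.half + 20 ∧ s'.mem = s.mem ∧
      s'.reg rPos = clausePos φ k + 1 + (j + 1) ∧
      s'.reg rAcc = (clauseTrue φ.half (i / 2 ^ φ.half) (i % 2 ^ φ.half)
        (φ.clauses[k].take (j + 1))).toNat := by
  have hb := writeBound_spec hW
  have ht := type_spec hi
  have hlit := encode_literal hk hj l
  have hle := (encode_clausePos hk l).2
  have hvar := φ.clauses[k][j].1.2
  have hbit := φ.clauses[k][j].2.toNat_lt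
  have hhalf : φ.half = φ.numVars / 2 + 1 := rfl
  simp only [Prog.clauseLitStep, wp_seq, wp_load, hpos, hmem, hlit]
  refine ⟨by omega, ?_⟩
  refine (wp_testLit (t := i / 2 ^ φ.half) (a := i % 2 ^ φ.half)
    (l := 2 * (φ.clauses[k][j].1 : ℕ) + φ.clauses[k][j].2.toNat)
    (hE.toParams.congr ?_) (by simp [hE.skip]) (by simp [hE.assign]) (by simp) (by omega)
    (by omega) (by omega) (by omega)).frame.mono ?_
  · intro r hr
    simp
    omega
  rintro T s' ⟨⟨hT, hmem', hbit'⟩, hfr⟩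
  have hor : s'.reg rAcc ||| s'.reg rBit = (clauseTrue φ.half (i / 2 ^ φ.half) (i % 2 ^ φ.half)
      (φ.clauses[k].take (j + 1))).toNat := by
    rw [hbit', hfr rAcc rfl]
    simp only [State.setReg_reg, hacc, List.take_add_one, List.getElem?_eq_getElem hj, clauseTrue,
      Option.toList_some, List.any_append, List.any_cons, List.any_nil, Bool.or_false]
    generalize List.any _ _ = x
    generalize litTrue _ _ _ _ = y
    cases x <;> cases y <;> simp
  simp only [wp_op, Op.eval, hor]
  simp [hfr rPos rfl, hfr rOne rfl, hE.one, hpos, hmem', hmem]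
  have := Bool.toNat_le (clauseTrue φ.half (i / 2 ^ φ.half) (i % 2 ^ φ.half)
        (φ.clauses[k].take (j + 1)))
  omega

open CNFFormula in
theorem wp_clauseStep {i k : ℕ} {l : List ℕ} (hE : EdgeParams φ i s) (hi : i < φ.edgeCount)
    (hk : k < φ.clauses.length) (hW : writeBound φ ≤ W)
    (hl : φ.encode.length + l.length + φ.vertexCount ≤ W)
    (h : Emitted (φ.encode ++ l) (φ.inEdge i) (4 * φ.half + k) s)
    (hpos : s.reg rPos = clausePos φ k) :
    wp W .clauseStep s t₀ fun T s' =>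
      T ≤ t₀ + φ.encode.length * (3 * φ.half + 22) + 11 ∧
      Emitted (φ.encode ++ l) (φ.inEdge i) (4 * φ.half + (k + 1)) s' ∧
      s'.reg rPos = clausePos φ (k + 1) := by
  have hb := writeBound_spec hW
  have ht := type_spec hi
  have hV : φ.vertexCount = 4 * φ.half + φ.clauses.length + 1 := rfl
  have hlen := encode_clausePos hk (l ++ (List.range (4 * φ.half + k)).filter (φ.inEdge i))
  have hmem := h.mem
  rw [List.append_assoc] at hmem
  simp only [Prog.clauseStep, wp_seq, wp_const, wp_load, wp_op, Op.eval]
  simp [hpos, hmem, hlen.1, hE.one]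
  refine ⟨by omega, by omega, ?_⟩
  refine wp_repeat (fun j s' => s'.mem = s.mem ∧ s'.reg rPos = clausePos φ k + 1 + j ∧
      s'.reg rAcc = (clauseTrue φ.half (i / 2 ^ φ.half) (i % 2 ^ φ.half)
        (φ.clauses[k].take j)).toNat) (3 * φ.half + 20) φ.clauses[k].length rfl rfl (by norm_num)
        (by simp) (by simp [hE.one]) (by omega) (by simp [clauseTrue]) ?_ ?_
  · rintro j hj s' ⟨hm, hp, hacc⟩ hfr
    refine (wp_clauseLitStep (l := l ++ (List.range (4 * φ.half + k)).filter (φ.inEdge i))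
      (hE.congr ?_) hi hk hj hW (hm.trans hmem) hp hacc).mono ?_
    · intro r hr
      fin_cases hr <;> exact hfr _ rfl
    · rintro T s'' ⟨hT, hm', hp', hacc'⟩
      exact ⟨by omega, by simp [hm', hm], by simp [hp'], by simp [hacc']⟩
  · rintro T s' hT ⟨hm, hp, hacc⟩ hfr
    rw [List.take_length] at hacc
    have hle := Bool.toNat_le
      (clauseTrue φ.half (i / 2 ^ φ.half) (i % 2 ^ φ.half) φ.clauses[k])
    have hcost : φ.clauses[k].length * (3 * φ.half + 20 + 2) ≤
        φ.encode.length * (3 * φ.half + 22) := Nat.mul_le_mul (by omega) (by omega)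
    simp [hacc, hfr rOne rfl, hfr rTwo rfl, hfr rType rfl, hE.one, hE.two, hE.type]
    refine ⟨by omega, by omega, by omega, ?_⟩
    refine (wp_emit (h.congr (by simp [hm]) (by simp [hfr rOut rfl]) (by simp [hfr rVert rfl]))
      (by simp [hfr rOne rfl, hE.one]) ?_ (by simp; omega)).frame.mono ?_
    · have : φ.inEdge i (4 * φ.half + k) = (((clauseTrue φ.half (i / 2 ^ φ.half)
          (i % 2 ^ φ.half) φ.clauses[k]).toNat + 1 + i / 2 ^ φ.half) % 2 == 1) := by
        simp [inEdge, hk]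
      rw [this]
      generalize (clauseTrue φ.half (i / 2 ^ φ.half)
          (i % 2 ^ φ.half) φ.clauses[k]).toNat + 1 + i / 2 ^ φ.half = y
      rcases Nat.mod_two_eq_zero_or_one y with hy | hy <;> simp [hy]
    · rintro T' s'' ⟨⟨hT', h'⟩, hfr'⟩
      refine ⟨by omega, h', ?_⟩
      rw [hfr' rPos rfl, clausePos_succ hk]
      simp [hp]
      omega

end RAM

namespace RAM

variable {W : ℕ} {s : State} {t₀ : ℕ} {φ : CNFFormula}

/-- A bound on the time for writing a hyperedge. -/
def edgeCost (φ : CNFFormula) : ℕ :=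
  4 * φ.half * (3 * φ.half + 25) +
    φ.clauses.length * (φ.encode.length * (3 * φ.half + 22) + 13) + 30

/-- The cardinality precedes the vertices in the code but is known only after them. So its cell is
skipped, and finally set to the number of cells written behind it. -/
theorem wp_edgeStep {i : ℕ} {l : List ℕ} (hP : Params φ s) (hi : i < φ.edgeCount)
    (hW : writeBound φ ≤ W) (hl : φ.encode.length + l.length + φ.vertexCount + 1 ≤ W)
    (hmem : s.mem = memOf (φ.encode ++ l)) (hout : s.reg rOut = φ.encode.length + l.length)
    (hedge : s.reg rEdge = i) :
    wp W .edgeStep s t₀ fun T s' => T ≤ t₀ + edgeCost φ ∧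
      s'.mem = memOf (φ.encode ++ (l ++ (φ.row i).length :: φ.row i)) ∧
      s'.reg rOut = φ.encode.length + (l ++ (φ.row i).length :: φ.row i).length ∧
      s'.reg rEdge = i + 1 := by
  have hb := writeBound_spec hW
  have ht := type_spec hi
  have hV : φ.vertexCount = 4 * φ.half + φ.clauses.length + 1 := rfl
  have hmem' : s.mem = memOf (φ.encode ++ (l ++ [0])) := by
    rw [← List.append_assoc, memOf_append_zero, hmem]
  simp only [Prog.edgeStep, wp_seq, wp_op, wp_copy, wp_const, wp_store, Op.eval]
  simp [hedge, hP.pow, hP.part, hP.one, hP.lits, hout]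
  refine ⟨by omega, by omega, by omega, by omega, by omega, by omega, ?_⟩
  refine wp_repeat (fun v s' => Emitted (φ.encode ++ (l ++ [0])) (φ.inEdge i) v s')
    (3 * φ.half + 23) (4 * φ.half) rfl rfl (by norm_num) (by simp) (by simp [hP.one]) (by omega)
    ⟨by simp [hmem'], by simp; omega, by simp⟩ ?_ ?_
  · intro v hv s' h hfr
    refine (wp_literalStep (i := i) ⟨hP.congr ?_, ?_, ?_, ?_⟩ h hi hv (by simp; omega) hW).mono ?_
    · intro r hr
      interval_cases r <;> exact hfr _ rfl
    · rw [hfr _ rfl]; simp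
    · rw [hfr _ rfl]; simp
    · rw [hfr _ rfl]; simp
    · rintro T s'' ⟨hT, h'⟩
      exact ⟨by omega, h'.congr (by simp) (by simp) (by simp)⟩
  intro T₁ s₁ hT₁ h₁ hfr₁
  refine ⟨by omega, ?_⟩
  simp [hfr₁ rClauses rfl, hP.clauses]
  refine ⟨by omega, ?_⟩
  refine wp_repeat (fun k s' => Emitted (φ.encode ++ (l ++ [0])) (φ.inEdge i) (4 * φ.half + k) s' ∧
      s'.reg rPos = clausePos φ k) (φ.encode.length * (3 * φ.half + 22) + 11) φ.clauses.length
    rfl rfl (by norm_num) (by simp) (by simp [hfr₁ rOne rfl, hP.one]) (by omega)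
    ⟨h₁.congr (by simp) (by simp) (by simp), by simp [clausePos]⟩ ?_ ?_
  · rintro k hk s' ⟨h, hpos⟩ hfr
    refine (wp_clauseStep (i := i) ⟨hP.congr ?_, ?_, ?_, ?_⟩ hi hk hW (by simp; omega) h
      hpos).mono ?_
    · intro r hr
      interval_cases r <;> rw [hfr _ rfl] <;> exact hfr₁ _ rfl
    · rw [hfr _ rfl]; simp [hfr₁ rType rfl]
    · rw [hfr _ rfl]; simp [hfr₁ rAssign rfl]
    · rw [hfr _ rfl]; simp [hfr₁ rSkip rfl]
    · rintro T s'' ⟨hT, h', hpos'⟩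
      exact ⟨by omega, h'.congr (by simp) (by simp) (by simp), by simp [hpos']⟩
  rintro T₂ s₂ hT₂ ⟨h₂, -⟩ hfr₂
  refine ⟨by omega, ?_⟩
  refine (wp_emit (h₂.congr (by simp) (by simp) (by simp))
    (by simp [hfr₂ rOne rfl, hfr₁ rOne rfl, hP.one]) (by simp [CNFFormula.inEdge_last])
    (by simp; omega)).frame.mono ?_
  rintro T₃ s₃ ⟨⟨hT₃, h₃⟩, hfr₃⟩
  have hcard : s₃.reg rCard = φ.encode.length + l.length := by
    rw [hfr₃ _ rfl]; simp [hfr₂ rCard rfl, hfr₁ rCard rfl]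
  have hone : s₃.reg rOne = 1 := by
    rw [hfr₃ _ rfl]; simp [hfr₂ rOne rfl, hfr₁ rOne rfl, hP.one]
  have hedge₃ : s₃.reg rEdge = i := by
    rw [hfr₃ _ rfl]; simp [hfr₂ rEdge rfl, hfr₁ rEdge rfl, hedge]
  have hrow := φ.length_row_le i
  have hmem₃ := h₃.mem
  have hout₃ := h₃.out
  rw [show 4 * φ.half + φ.clauses.length + 1 = φ.vertexCount from rfl] at hmem₃ hout₃
  change s₃.mem = memOf (φ.encode ++ (l ++ [0]) ++ φ.row i) at hmem₃
  change s₃.reg rOut = (φ.encode ++ (l ++ [0]) ++ φ.row i).length at hout₃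
  simp only [List.length_append, List.length_singleton] at hout₃
  simp [hout₃, hcard, hone, hedge₃]
  rw [show φ.encode.length + (l.length + 1) + (φ.row i).length - (φ.encode.length + l.length) - 1 =
    (φ.row i).length by omega]
  rw [show 3 * φ.half + 23 + 2 = 3 * φ.half + 25 from rfl] at hT₁
  rw [show φ.encode.length * (3 * φ.half + 22) + 11 + 2 =
    φ.encode.length * (3 * φ.half + 22) + 13 from rfl] at hT₂
  refine ⟨by omega, by omega, by omega, by rw [edgeCost]; omega, ?_, by omega⟩
  rw [hmem₃, ← List.length_append]
  have := update_memOf_middle (φ.encode ++ l) (φ.row i) (φ.row i).length 0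
  simpa using this

theorem length_encode_le (φ : CNFFormula) : φ.encode.length ≤ φ.size + 1 ∧
    2 + φ.clauses.length ≤ φ.encode.length := by
  have h : (φ.clauses.flatMap fun c => c.length :: c.map fun l => 2 * (l.1 : ℕ) + l.2.toNat).length
      = (φ.clauses.map fun c => c.length + 1).sum := by
    simp [List.length_flatMap]
  have h' : φ.clauses.length ≤ (φ.clauses.map fun c => c.length + 1).sum := by
    rw [List.sum_map_add]
    simp
  rw [CNFFormula.encode, CNFFormula.size, List.length_cons, List.length_cons, h]
  omega

theorem wp_readFormula (hW : writeBound φ ≤ W) :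
    wp W .readFormula (.initial φ.encode) t₀ fun T s' => T ≤ t₀ + 3 * φ.half + 20 ∧
      s'.mem = memOf φ.encode ∧ Params φ s' := by
  have hb := writeBound_spec hW
  have hlen := length_encode_le φ
  have hh : φ.numVars / 2 + 1 = φ.half := rfl
  have hV : φ.vertexCount = 4 * φ.half + φ.clauses.length + 1 := rfl
  have hE : φ.edgeCount = 2 * 2 ^ φ.half + 1 := rfl
  -- Cell 0 is addressed through `rTemp`, which is still `0` in the initial state, and cell 1
  -- through `rOne`.
  have hm0 : φ.encode.getD 0 0 = φ.numVars := rfl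
  have hm1 : φ.encode.getD 1 0 = φ.clauses.length := rfl
  simp only [Prog.readFormula, wp_seq, wp_op, wp_copy, wp_const, wp_load, Op.eval]
  simp [State.initial, -List.getD_eq_getElem?_getD, hm0, hm1, hh]
  refine ⟨by omega, by omega, by omega, by omega, by omega, by omega, by omega, by omega,
    by omega, ?_⟩
  refine wp_repeat (fun j s' => s'.mem = memOf φ.encode ∧ s'.reg rPow = 2 ^ j) 1 φ.half rfl rfl
    (by norm_num) (by simp) (by simp) (by omega) ⟨rfl, by simp⟩ ?_ ?_
  · rintro k hk s' ⟨hm, hp⟩ hfr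
    have : 2 ^ (k + 1) ≤ 2 ^ φ.half := Nat.pow_le_pow_right two_pos hk
    rw [pow_succ] at this
    simp [wp_op, Op.eval, hp, hfr 2 rfl, hm, pow_succ]
    omega
  · rintro T s' hT ⟨hm, hp⟩ hfr
    simp [hp, hfr 1 rfl, hfr 2 rfl, hfr rHalf rfl, hfr rClauses rfl, hm]
    refine ⟨by omega, by omega, by omega, by omega, by omega, by omega, by omega, ?_⟩
    constructor <;>
      simp [hfr 1 rfl, hfr 2 rfl, hfr rVars rfl, hfr rClauses rfl, hfr rBase rfl, hp] <;> omega

/-- A bound on the time for writing the hypergraph. -/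
def writeCost (φ : CNFFormula) : ℕ :=
  3 * φ.half + φ.edgeCount * (edgeCost φ + 2) + 30

theorem wp_writeHypergraph (hW : writeBound φ ≤ W) :
    wp W .writeHypergraph (.initial φ.encode) t₀ fun T s' => T ≤ t₀ + writeCost φ ∧
      s'.mem = memOf (φ.encode ++ φ.hypergraph.encode) ∧ Params φ s' ∧
      s'.reg rOut = φ.encode.length + φ.hypergraph.encode.length := by
  have hb := writeBound_spec hW
  rw [Prog.writeHypergraph, wp_seq]
  refine (wp_readFormula hW).mono ?_
  rintro T s ⟨hT, hmem, hP⟩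
  simp only [wp_seq, wp_op, wp_copy, wp_const, wp_store, Op.eval]
  simp [hP.base, hP.verts, hP.edges, hP.one]
  refine ⟨by omega, by omega, by omega, by omega, by omega, by omega, ?_⟩
  -- What stands behind the formula after `i` hyperedges have been written, including the two header
  -- entries.
  obtain ⟨rows, rows_def⟩ : ∃ rows : ℕ → List ℕ, rows = fun i => φ.vertexCount :: φ.edgeCount ::
    (List.range i).flatMap fun i => (φ.row i).length :: φ.row i := ⟨_, rfl⟩
  have hsucc : ∀ i, rows (i + 1) = rows i ++ (φ.row i).length :: φ.row i := by
    intro i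
    simp [rows_def, List.range_succ]
  have hle : ∀ i, (rows i).length ≤ 2 + i * (φ.vertexCount + 1) := by
    intro i
    induction i with
    | zero => simp [rows_def]
    | succ i ih =>
      have := φ.length_row_le i
      rw [hsucc, List.length_append, List.length_cons, add_mul]
      omega
  refine wp_repeat (fun i s' => s'.mem = memOf (φ.encode ++ rows i) ∧
      s'.reg rOut = φ.encode.length + (rows i).length ∧ s'.reg rEdge = i) (edgeCost φ) φ.edgeCount
    rfl rfl (by norm_num) (by simp) (by simp [hP.one]) (by omega) ⟨?_, ?_, by simp⟩ ?_ ?_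
  · have h₁ := update_memOf_append φ.encode φ.vertexCount
    have h₂ := update_memOf_append (φ.encode ++ [φ.vertexCount]) φ.edgeCount
    rw [List.length_append, List.length_singleton] at h₂
    simp [hmem, h₁, h₂, rows_def]
  · simp [rows_def]
  · rintro i hi s' ⟨hm, ho, he⟩ hfr
    have h₁ := hle i
    have h₂ : (i + 1) * (φ.vertexCount + 1) ≤ φ.edgeCount * (φ.vertexCount + 1) := by
      gcongr
      omega
    rw [add_mul] at h₂
    rw [writeBound] at hW
    refine (wp_edgeStep (i := i) (l := rows i) (hP.congr ?_) hi hW (by omega) hm ho he).mono ?_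
    · intro r hr
      interval_cases r <;> exact hfr _ rfl
    · rintro T' s'' ⟨hT', hm', ho', he'⟩
      rw [← hsucc] at hm' ho'
      exact ⟨by omega, by simp [hm'], by simp [ho'], by simp [he']⟩
  · rintro T' s' hT' ⟨hm, ho, he⟩ hfr
    have hrows : rows φ.edgeCount = φ.hypergraph.encode := by
      rw [rows_def, φ.encode_hypergraph]
    rw [hrows] at hm ho
    refine ⟨by rw [writeCost]; omega, hm, hP.congr ?_, ho⟩
    intro r hr
    interval_cases r <;> exact hfr _ rfl

end RAM

/-! ### The algorithm for satisfiability -/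

namespace RAM

namespace Prog

/-- Set up the simulation: the word size is `C * N ^ k`, and the clock is at
`C * (N ^ 2 / 2 ^ (n / q) + 1)`, where `n` is the number of variables. -/
def setup (C k q : ℕ) : Prog :=
  .op .sub 40 rOut rBase ;; .op .sub rEdge 40 rTwo ;; .op .sub rEdge rEdge rEdges ;;
    .const rBound C ;; .const rCountA k ;; .repeat rCountA (.op .mul rBound rBound rEdge) ;;
    .const rTemp q ;; .op .div rCountA rVars rTemp ;; .const rTest 1 ;;
    .repeat rCountA (.op .mul rTest rTest rTwo) ;;
    .op .mul rTemp rEdge rEdge ;; .op .div rTemp rTemp rTest ;; .op .add rTemp rTemp rOne ;;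
    .const rClock C ;; .op .mul rClock rClock rTemp ;; .const rAlive 1

/-- Answer `0` if the simulation has found exactly one edge less than there are hyperedges, and `1`
otherwise. -/
def answer : Prog :=
  .ite rAlive
    (.op .mul rTemp rTwo rEdges ;; .op .sub rTemp rTemp rTwo ;; .op .xor rTemp rTemp 40 ;;
      .ite rTemp (.const rTemp 1) .skip)
    (.const rTemp 1) ;;
  .const rTest 0 ;; .store rTest rTemp ;; .const 0 1

/-- Decide satisfiability with the help of a program `p` that constructs union join graphs. -/
def solveSat (p : Prog) (C k q : ℕ) : Prog :=
  writeHypergraph ;; setup C k q ;; sim p ;; answer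

/-- The simulated machine must start with all registers except register 0 equal to `0`. Their images
are the registers from 41 on, which no program running before the simulation writes; see also
`writes_setup`. -/
theorem writes_writeHypergraph {r : ℕ} (hr : 30 ≤ r) : writeHypergraph.writes r = false := by
  simp [writeHypergraph, readFormula, edgeStep, clauseStep, clauseLitStep, literalStep, emit,
    testLit, Prog.repeat, copy, writes]
  omega

theorem writes_setup {C k q r : ℕ} (hr : 40 < r) : (setup C k q).writes r = false := by
  simp [setup, Prog.repeat, writes]
  omega

end Prog

/-! ### Correctness of the algorithm for satisfiability -/

variable {W : ℕ} {s : State} {t₀ : ℕ} {φ : CNFFormula}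

/-- The number of time units for which a program is simulated. -/
def timeLimit (φ : CNFFormula) (C q : ℕ) : ℕ :=
  C * (φ.hypergraph.totalSize * φ.hypergraph.totalSize / 2 ^ (φ.numVars / q) + 1)

/-- A number that is at least as large as all relevant quantities of the algorithm. -/
def magnitude (φ : CNFFormula) (p : Prog) (C k q : ℕ) : ℕ :=
  p.maxConst + C + k + q + φ.encode.length + φ.vertexCount +
    φ.edgeCount * (φ.vertexCount + 1) + 2 ^ φ.numVars + C * φ.hypergraph.totalSize ^ k +
    (C + 1) * (φ.hypergraph.totalSize * φ.hypergraph.totalSize + 1) + 20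

theorem wp_setup {p : Prog} {C k q : ℕ} (hW : magnitude φ p C k q ≤ W) (hP : Params φ s)
    (hout : s.reg rOut = φ.encode.length + φ.hypergraph.encode.length) :
    wp W (.setup C k q) s t₀ fun T s' => T ≤ t₀ + 3 * k + 3 * φ.numVars + 20 ∧
      s'.mem = s.mem ∧ s'.reg 40 = φ.hypergraph.encode.length ∧
      s'.reg rBound = C * φ.hypergraph.totalSize ^ k ∧ s'.reg rClock = timeLimit φ C q ∧
      s'.reg rAlive = 1 := by
  have hlen := φ.length_encode_hypergraph
  have hm := φ.edgeCount_le_totalSize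
  have hdiv := Nat.div_le_self φ.numVars q
  have hn := Nat.lt_two_pow_self (n := φ.numVars)
  have hpos : 0 < φ.edgeCount := Nat.succ_pos _
  obtain ⟨N, hN⟩ : ∃ N, N = φ.hypergraph.totalSize := ⟨_, rfl⟩
  rw [← hN] at hlen hm
  simp only [magnitude, ← hN] at hW
  have hNN : N ≤ N * N := Nat.le_mul_self N
  have hdiv' : N * N / 2 ^ (φ.numVars / q) ≤ N * N := Nat.div_le_self _ _
  have hC : (C + 1) * (N * N + 1) = C * (N * N + 1) + N * N + 1 := by ring
  have hlim : C * (N * N / 2 ^ (φ.numVars / q) + 1) ≤ C * (N * N + 1) := by gcongr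
  have hmV : φ.edgeCount * 1 ≤ φ.edgeCount * (φ.vertexCount + 1) := by gcongr; omega
  simp only [Prog.setup, wp_seq, wp_op, wp_const, Op.eval]
  simp [hout, hP.base, hP.two, hP.edges]
  rw [show φ.hypergraph.encode.length - 2 - φ.edgeCount = N by omega]
  refine ⟨by omega, by omega, by omega, by omega, by omega, ?_⟩
  refine wp_repeat (fun j s' => s'.mem = s.mem ∧ s'.reg rBound = C * N ^ j) 1 k rfl rfl
    (by norm_num) (by simp) (by simp [hP.one]) (by omega) (by simp) ?_ ?_
  · rintro j hj s' ⟨hm, hb⟩ hfr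
    have : C * N ^ (j + 1) ≤ C * N ^ k := by
      gcongr
      · omega
      · omega
    simp [wp_op, Op.eval, hb, hfr rEdge rfl, hm]
    rw [mul_assoc, ← pow_succ]
    exact ⟨by omega, rfl⟩
  rintro T₁ s₁ hT₁ ⟨hm₁, hb₁⟩ hfr₁
  simp [hfr₁ rVars rfl, hP.vars]
  refine ⟨by omega, by omega, by omega, ?_⟩
  refine wp_repeat (fun j s' => s'.mem = s.mem ∧ s'.reg rTest = 2 ^ j) 1 (φ.numVars / q) rfl rfl
    (by norm_num) (by simp) (by simp [hfr₁ 1 rfl, hP.one]) (by omega) (by simp [hm₁]) ?_ ?_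
  · rintro j hj s' ⟨hm, hb⟩ hfr
    have : 2 ^ (j + 1) ≤ 2 ^ φ.numVars := Nat.pow_le_pow_right two_pos (by omega)
    simp [wp_op, Op.eval, hb, hfr rTwo rfl, hfr₁ rTwo rfl, hP.two, hm, ← pow_succ]
    omega
  rintro T₂ s₂ hT₂ ⟨hm₂, hb₂⟩ hfr₂
  simp [hfr₂ rEdge rfl, hfr₁ rEdge rfl, hfr₂ rOne rfl, hfr₁ rOne rfl, hP.one, hb₂, hm₂,
    hfr₂ 40 rfl, hfr₁ 40 rfl, hfr₂ rBound rfl, hb₁, timeLimit, ← hN]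
  refine ⟨by omega, by omega, by omega, by omega, by omega, by omega, by omega⟩

theorem memOf_encode_hypergraph_le (φ : CNFFormula) (x : ℕ) :
    memOf φ.hypergraph.encode x ≤ φ.edgeCount + φ.vertexCount := by
  have h : ∀ y ∈ φ.hypergraph.encode, y ≤ φ.edgeCount + φ.vertexCount := by
    intro y hy
    rw [φ.encode_hypergraph] at hy
    simp only [List.mem_cons, List.mem_flatMap, List.mem_range, CNFFormula.row,
      List.mem_filter] at hy
    obtain rfl | rfl | ⟨i, -, rfl | ⟨hy, -⟩⟩ := hy
    · omega
    · omega
    · have := φ.length_row_le i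
      rw [CNFFormula.row] at this
      omega
    · omega
  rw [memOf, List.getD_eq_getElem?_getD]
  by_cases hx : x < φ.hypergraph.encode.length
  · rw [List.getElem?_eq_getElem hx]
    exact h _ (List.getElem_mem hx)
  · rw [List.getElem?_eq_none (by omega)]
    exact Nat.zero_le _

theorem output_eq_singleton {x : ℕ} (h0 : s.reg 0 = 1) (hm : s.mem 0 = x) : s.output = [x] := by
  simp [State.output, h0, hm]

/-- A bound on the time that the algorithm takes. -/
def solveCost (φ : CNFFormula) (p : Prog) (C k q : ℕ) : ℕ :=
  writeCost φ + 3 * k + 3 * φ.numVars + p.simCost * (timeLimit φ C q + 1) + 30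

open Classical in
-- If the simulation completes, `hsound` makes the number of listed edges trustworthy for every
-- formula. The time bound `hhalt` is available only for unsatisfiable formulas, and that suffices:
-- a stopped simulation then proves satisfiability.
theorem wp_solveSat {p : Prog} {C k q : ℕ}
    (hW : 5 * (magnitude φ p C k q * magnitude φ p C k q) ≤ W)
    (hsound : ∀ t s, Exec (C * φ.hypergraph.totalSize ^ k) p (.initial φ.hypergraph.encode) t s →
      IsEdgeList φ.hypergraph.unionJoinGraph s.output)
    (hhalt : ¬ φ.Satisfiable → ∃ t s, Exec (C * φ.hypergraph.totalSize ^ k) p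
      (.initial φ.hypergraph.encode) t s ∧ t ≤ timeLimit φ C q) :
    wp W (.solveSat p C k q) (.initial φ.encode) 0 fun T s => T ≤ solveCost φ p C k q ∧
      s.output = [if φ.Satisfiable then 1 else 0] := by
  obtain ⟨D, hD⟩ : ∃ D, D = magnitude φ p C k q := ⟨_, rfl⟩
  rw [← hD] at hW
  have hlen := φ.length_encode_hypergraph
  have hedges := φ.edgeCount_le_totalSize
  have hD' := hD
  rw [magnitude] at hD'
  have hNN := Nat.le_mul_self φ.hypergraph.totalSize
  have hC : (C + 1) * (φ.hypergraph.totalSize * φ.hypergraph.totalSize + 1) =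
    C * (φ.hypergraph.totalSize * φ.hypergraph.totalSize + 1) +
      φ.hypergraph.totalSize * φ.hypergraph.totalSize + 1 := by ring
  have hlim : timeLimit φ C q ≤
      C * (φ.hypergraph.totalSize * φ.hypergraph.totalSize + 1) := by
    rw [timeLimit]
    gcongr
    exact Nat.div_le_self _ _
  have hpow : 0 < 2 ^ φ.numVars := by positivity
  -- The summand `20` in `magnitude` is there so that multiples of `D` are absorbed by `D * D`.
  have hD20 : 20 * D ≤ D * D := Nat.mul_le_mul_right _ (by omega)
  have hmV : φ.edgeCount * (φ.vertexCount + 1) = φ.edgeCount * φ.vertexCount + φ.edgeCount := by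
    ring
  have hpos : 0 < φ.edgeCount := Nat.succ_pos _
  have hN := φ.totalSize_le
  rw [Prog.solveSat, wp_seq]
  refine (wp_writeHypergraph (by rw [writeBound]; omega)).frame.mono ?_
  rintro T₁ s₁ ⟨⟨hT₁, hmem₁, hP₁, hout₁⟩, hfr₁⟩
  rw [wp_seq]
  refine (wp_setup (p := p) (C := C) (k := k) (q := q) (by rw [← hD]; omega) hP₁
    hout₁).frame.mono ?_
  rintro T₂ s₂ ⟨⟨hT₂, hmem₂, hlen₂, hbound₂, hclock₂, halive₂⟩, hfr₂⟩
  have hP₂ : Params φ s₂ := hP₁.congr fun r hr => by interval_cases r <;> exact hfr₂ _ rfl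
  -- The hypergraph was written directly behind the formula and thus already stands where the
  -- simulated machine expects its input. All words are bounded by `D` and not by `C * N ^ k`,
  -- because `Exec` restricts only the values that are written, not those of the input.
  have hsim : Simulates φ.encode.length (C * φ.hypergraph.totalSize ^ k) D
      (.initial φ.hypergraph.encode) s₂ := by
    refine ⟨fun j => ?_, fun x => ?_, hP₂.one, hP₂.base, hbound₂, halive₂, fun j => ?_,
      fun x => ?_⟩
    · rcases j.eq_zero_or_pos with rfl | hj
      · simpa [State.initial] using hlen₂
      · rw [hfr₂ _ (Prog.writes_setup (by omega)),
          hfr₁ _ (Prog.writes_writeHypergraph (by omega))]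
        simp [State.initial, hj.ne']
    · rw [hmem₂, hmem₁, memOf, List.getD_append_right _ _ _ _ (by omega), Nat.add_sub_cancel_left]
      rfl
    · simp only [State.initial]
      split_ifs <;> omega
    · have h := memOf_encode_hypergraph_le φ x
      change memOf φ.hypergraph.encode x ≤ D
      omega
  rw [wp_seq]
  refine (wp_sim p (W := W) (τ := timeLimit φ C q) (by omega) (by omega) (by omega) (by omega) hsim
    hclock₂).frame.mono ?_
  rintro T₃ s₃ ⟨hpost, hfr₃⟩
  have hP₃ : Params φ s₃ := hP₂.congr fun r hr => hfr₃ r (Prog.writes_sim (by omega))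
  simp only [Prog.answer, wp_seq, wp_op, wp_ite, wp_const, wp_skip, wp_store, Op.eval]
  simp [hP₃.two, hP₃.edges]
  rcases hpost with ⟨t, s', ht, he, hs', -, hT₃⟩ | ⟨hst, hno, hT₃⟩
  · have hcost : p.simCost * t ≤ p.simCost * (timeLimit φ C q + 1) := by gcongr; omega
    -- Register 40 is the simulated register 0, which holds the length of the output, twice the
    -- number of edges. Therefore the comparison in `answer` is with `2 * m - 2`.
    have hlist := (hsound t s' he).length_eq
    have hreg : s₃.reg 40 = 2 * φ.hypergraph.unionJoinGraph.edgeSet.ncard := by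
      rw [← hlist, show 40 = 0 + 40 from rfl, hs'.reg]
      simp [State.output]
    have hle : s₃.reg 40 ≤ D := by
      rw [show 40 = 0 + 40 from rfl, hs'.reg]
      exact hs'.reg_le 0
    have hxor := Op.eval_le .xor (show 2 * φ.edgeCount - 2 ≤ D by omega) hle
    simp only [Op.eval] at hxor
    refine ⟨fun _ => ⟨by omega, by omega, by omega, fun hne => ⟨by omega, ?_, ?_⟩,
      fun heq => ⟨by omega, by omega, ?_, ?_⟩⟩, fun h => by simp [hs'.alive] at h⟩
    · rw [solveCost]; omega
    · have hsat : φ.Satisfiable := by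
        by_contra h
        have := φ.ncard_edgeSet_of_not_satisfiable h
        omega
      rw [if_pos hsat]
      exact output_eq_singleton (by simp) (by simp)
    · rw [solveCost]; omega
    · have hsat : ¬ φ.Satisfiable := by
        intro h
        have := h.edgeCount_le_ncard_edgeSet
        omega
      rw [if_neg hsat]
      exact output_eq_singleton (by simp) (by simp [heq])
  · have hsat : φ.Satisfiable := by
      by_contra h
      obtain ⟨t, s', he, ht⟩ := hhalt h
      have := hno t s' he
      omega
    refine ⟨fun h => absurd hst.alive h, fun _ => ⟨by omega, ?_, ?_⟩⟩
    · rw [solveCost]; omega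
    · rw [if_pos hsat]
      exact output_eq_singleton (by simp) (by simp)

end RAM

/-! ### Running time -/

namespace RAM

variable (φ : CNFFormula)

theorem size_spec : 1 ≤ φ.size ∧ φ.numVars + 1 ≤ φ.size ∧ φ.half ≤ φ.size ∧
    φ.clauses.length ≤ φ.size ∧ φ.vertexCount ≤ 5 * φ.size ∧ φ.encode.length ≤ 2 * φ.size := by
  have h := length_encode_le φ
  have h' : φ.clauses.length ≤ (φ.clauses.map fun c => c.length + 1).sum := by
    rw [List.sum_map_add]
    simp
  have h₁ : φ.size = 1 + φ.numVars + (φ.clauses.map fun c => c.length + 1).sum := rfl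
  have h₂ : φ.half = φ.numVars / 2 + 1 := rfl
  have h₃ : φ.vertexCount = 4 * φ.half + φ.clauses.length + 1 := rfl
  omega

theorem totalSize_le_size : φ.hypergraph.totalSize ≤ 15 * (2 ^ φ.half * φ.size) := by
  have hV := (size_spec φ).2.2.2.2.1
  have h1 : 0 < 2 ^ φ.half := by positivity
  calc φ.hypergraph.totalSize ≤ φ.edgeCount * φ.vertexCount := φ.totalSize_le
    _ ≤ (3 * 2 ^ φ.half) * (5 * φ.size) := by
        refine Nat.mul_le_mul ?_ hV
        rw [CNFFormula.edgeCount]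
        omega
    _ = 15 * (2 ^ φ.half * φ.size) := by ring

theorem two_pow_half_mul_self : 2 ^ φ.half * 2 ^ φ.half ≤ 4 * 2 ^ φ.numVars ∧
    2 ^ φ.numVars ≤ 2 ^ φ.half * 2 ^ φ.half := by
  have h : φ.half = φ.numVars / 2 + 1 := rfl
  rw [← pow_add]
  constructor
  · calc 2 ^ (φ.half + φ.half) ≤ 2 ^ (φ.numVars + 2) := Nat.pow_le_pow_right two_pos (by omega)
      _ = 4 * 2 ^ φ.numVars := by ring
  · exact Nat.pow_le_pow_right two_pos (by omega)

theorem totalSize_mul_self_le : φ.hypergraph.totalSize * φ.hypergraph.totalSize ≤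
    900 * (2 ^ φ.numVars * φ.size ^ 2) := by
  have h := totalSize_le_size φ
  calc φ.hypergraph.totalSize * φ.hypergraph.totalSize
      ≤ (15 * (2 ^ φ.half * φ.size)) * (15 * (2 ^ φ.half * φ.size)) := Nat.mul_le_mul h h
    _ = 225 * (2 ^ φ.half * 2 ^ φ.half) * φ.size ^ 2 := by ring
    _ ≤ 225 * (4 * 2 ^ φ.numVars) * φ.size ^ 2 := by
        exact Nat.mul_le_mul_right _ (Nat.mul_le_mul_left _ (two_pow_half_mul_self φ).1)
    _ = 900 * (2 ^ φ.numVars * φ.size ^ 2) := by ring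

theorem two_pow_le_totalSize_mul_self :
    2 ^ φ.numVars ≤ φ.hypergraph.totalSize * φ.hypergraph.totalSize := by
  have h : 2 ^ φ.half ≤ φ.hypergraph.totalSize := by
    have := φ.edgeCount_le_totalSize
    have h' : φ.edgeCount = 2 * 2 ^ φ.half + 1 := rfl
    omega
  exact (two_pow_half_mul_self φ).2.trans (Nat.mul_le_mul h h)

variable {φ}

/-- `N ^ 2` is at most `900 * 2 ^ n * size ^ 2`, and dividing by `2 ^ (n / q)` saves that power of
two. The constant `901` absorbs the additional `1` in the time limit. -/
theorem timeLimit_le {C q : ℕ} :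
    timeLimit φ C q ≤ 901 * C * (2 ^ (φ.numVars - φ.numVars / q) * φ.size ^ 2) := by
  have h1 : 1 ≤ 2 ^ (φ.numVars - φ.numVars / q) * φ.size ^ 2 :=
    Nat.mul_pos (by positivity) (pow_pos (size_spec φ).1 2)
  have h2 : φ.hypergraph.totalSize * φ.hypergraph.totalSize / 2 ^ (φ.numVars / q) ≤
      900 * (2 ^ (φ.numVars - φ.numVars / q) * φ.size ^ 2) := by
    refine Nat.div_le_of_le_mul ((totalSize_mul_self_le φ).trans (le_of_eq ?_))
    have : 2 ^ φ.numVars = 2 ^ (φ.numVars / q) * 2 ^ (φ.numVars - φ.numVars / q) := by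
      rw [← pow_add, Nat.add_sub_cancel' (Nat.div_le_self _ _)]
    rw [this]
    ring
  calc timeLimit φ C q ≤ C * (901 * (2 ^ (φ.numVars - φ.numVars / q) * φ.size ^ 2)) :=
        Nat.mul_le_mul_left _ (by omega)
    _ = _ := by ring

theorem writeCost_le {q : ℕ} (hq : 2 ≤ q) :
    writeCost φ ≤ 1300 * (2 ^ (φ.numVars - φ.numVars / q) * φ.size ^ 3) := by
  obtain ⟨hS, -, hh, hL, -, hE⟩ := size_spec φ
  have hcost : edgeCost φ + 2 ≤ 207 * φ.size ^ 3 := by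
    have h₁ : 4 * φ.half * (3 * φ.half + 25) ≤ 4 * φ.size * (3 * φ.size + 25 * φ.size) := by
      gcongr
      omega
    have h₂ : φ.clauses.length * (φ.encode.length * (3 * φ.half + 22) + 13) ≤
        φ.size * (2 * φ.size * (3 * φ.size + 22 * φ.size) + 13 * (φ.size * φ.size)) := by
      gcongr
      · omega
      · nlinarith
    have h₃ : φ.size * φ.size ≤ φ.size ^ 3 := by
      rw [← pow_two]
      exact Nat.pow_le_pow_right hS (by norm_num)
    have h₄ : 1 ≤ φ.size ^ 3 := Nat.one_le_pow _ _ hS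
    have h₅ : 4 * φ.size * (3 * φ.size + 25 * φ.size) = 112 * (φ.size * φ.size) := by ring
    have h₆ : φ.size * (2 * φ.size * (3 * φ.size + 22 * φ.size) + 13 * (φ.size * φ.size)) =
      63 * φ.size ^ 3 := by ring
    rw [edgeCost]
    omega
  have hA : φ.edgeCount ≤ 6 * 2 ^ (φ.numVars - φ.numVars / q) := by
    -- Here `2 ≤ q` is needed: the number of hyperedges, about `2 ^ (n / 2)`, must not exceed the
    -- order of `2 ^ (n - n / q)`.
    have h₁ : φ.numVars / q ≤ φ.numVars / 2 := Nat.div_le_div_left hq two_pos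
    have h₂ : φ.half = φ.numVars / 2 + 1 := rfl
    have h₃ : 2 ^ φ.half ≤ 2 ^ (φ.numVars - φ.numVars / q + 1) :=
      Nat.pow_le_pow_right two_pos (by omega)
    have h₄ : 1 ≤ 2 ^ (φ.numVars - φ.numVars / q) := Nat.one_le_two_pow
    rw [pow_succ] at h₃
    rw [CNFFormula.edgeCount]
    omega
  have hS3 : φ.size ≤ φ.size ^ 3 := Nat.le_self_pow (by norm_num) _
  have hAS : φ.size ^ 3 ≤ 2 ^ (φ.numVars - φ.numVars / q) * φ.size ^ 3 :=
    Nat.le_mul_of_pos_left _ (by positivity)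
  have hmul : φ.edgeCount * (edgeCost φ + 2) ≤
      1242 * (2 ^ (φ.numVars - φ.numVars / q) * φ.size ^ 3) :=
    (Nat.mul_le_mul hA hcost).trans (le_of_eq (by ring))
  rw [writeCost]
  omega

theorem solveCost_le {p : Prog} {C k q : ℕ} (hq : 2 ≤ q) : solveCost φ p C k q ≤
    (1400 + 3 * k + p.simCost * (901 * C + 1)) *
      (2 ^ (φ.numVars - φ.numVars / q) * φ.size ^ 3) := by
  obtain ⟨hS, hn, -⟩ := size_spec φ
  obtain ⟨X, hX⟩ : ∃ X, X = 2 ^ (φ.numVars - φ.numVars / q) * φ.size ^ 3 := ⟨_, rfl⟩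
  have hXS : φ.size ≤ X := by
    rw [hX]
    exact (Nat.le_self_pow (by norm_num) _).trans (Nat.le_mul_of_pos_left _ (by positivity))
  have hw : writeCost φ ≤ 1300 * X := hX ▸ writeCost_le hq
  have hX2 : 2 ^ (φ.numVars - φ.numVars / q) * φ.size ^ 2 ≤ X := by
    rw [hX]
    exact Nat.mul_le_mul_left _ (Nat.pow_le_pow_right hS (by norm_num))
  have hl : timeLimit φ C q + 1 ≤ (901 * C + 1) * X := by
    have : 901 * C * (2 ^ (φ.numVars - φ.numVars / q) * φ.size ^ 2) ≤ 901 * C * X :=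
      Nat.mul_le_mul_left _ hX2
    have h' := timeLimit_le (φ := φ) (C := C) (q := q)
    rw [add_mul]
    omega
  have hs : p.simCost * (timeLimit φ C q + 1) ≤ p.simCost * ((901 * C + 1) * X) :=
    Nat.mul_le_mul_left _ hl
  have hk : k * 1 ≤ k * X := Nat.mul_le_mul_left _ (by omega)
  rw [← hX, solveCost]
  have : (1400 + 3 * k + p.simCost * (901 * C + 1)) * X =
    1400 * X + 3 * (k * X) + p.simCost * ((901 * C + 1) * X) := by ring
  omega

/-- The constant factor in a bound on the words of the algorithm. -/
def magnitudeFactor (p : Prog) (C k q : ℕ) : ℕ :=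
  p.maxConst + C + k + q + C * 30 ^ k + 901 * (C + 1) + 100

theorem magnitude_le {p : Prog} {C k q : ℕ} : magnitude φ p C k q ≤
    magnitudeFactor p C k q * (2 ^ φ.numVars * φ.size) ^ (2 * k + 4) := by
  obtain ⟨hS, hn, hh, hL, hV, hE⟩ := size_spec φ
  obtain ⟨Z, hZ⟩ : ∃ Z, Z = 2 ^ φ.numVars * φ.size := ⟨_, rfl⟩
  have hSZ : φ.size ≤ Z := by rw [hZ]; exact Nat.le_mul_of_pos_left _ (by positivity)
  have hpZ : 2 ^ φ.numVars ≤ Z := by rw [hZ]; exact Nat.le_mul_of_pos_right _ hS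
  have hZ1 : 1 ≤ Z := hS.trans hSZ
  have hm : φ.edgeCount ≤ 6 * Z := by
    have h₂ : φ.half = φ.numVars / 2 + 1 := rfl
    have h₃ : 2 ^ φ.half ≤ 2 ^ (φ.numVars + 1) := Nat.pow_le_pow_right two_pos (by omega)
    have h₄ : 1 ≤ 2 ^ φ.numVars := Nat.one_le_two_pow
    rw [pow_succ] at h₃
    rw [CNFFormula.edgeCount]
    omega
  have hN : φ.hypergraph.totalSize ≤ 30 * Z ^ 2 :=
    φ.totalSize_le.trans ((Nat.mul_le_mul hm (hV.trans (Nat.mul_le_mul_left 5 hSZ))).trans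
      (le_of_eq (by ring)))
  -- Since `N ≤ 30 * Z ^ 2`, the exponent `2 * k` takes care of `N ^ k`, and `4` of `N ^ 2`. Crude
  -- bounds suffice, as words may be polynomial in `2 ^ n * size`.
  obtain ⟨Y, hY⟩ : ∃ Y, Y = Z ^ (2 * k + 4) := ⟨_, rfl⟩
  have hY' : ∀ j ≤ 2 * k + 4, Z ^ j ≤ Y := fun j hj => hY ▸ Nat.pow_le_pow_right hZ1 hj
  have hY0 : 1 ≤ Y := by simpa using hY' 0 (by omega)
  have hY1 : Z ≤ Y := by simpa using hY' 1 (by omega)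
  have h₁ : φ.edgeCount * (φ.vertexCount + 1) ≤ 36 * Y := by
    refine (Nat.mul_le_mul hm (show φ.vertexCount + 1 ≤ 6 * Z by omega)).trans ?_
    have := hY' 2 (by omega)
    rw [show 6 * Z * (6 * Z) = 36 * Z ^ 2 by ring]
    omega
  have h₂ : C * φ.hypergraph.totalSize ^ k ≤ C * 30 ^ k * Y := by
    rw [mul_assoc]
    refine Nat.mul_le_mul_left _ ((Nat.pow_le_pow_left hN k).trans ?_)
    rw [mul_pow, ← pow_mul]
    exact Nat.mul_le_mul_left _ (hY' _ (by omega))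
  have h₃ : (C + 1) * (φ.hypergraph.totalSize * φ.hypergraph.totalSize + 1) ≤
      901 * (C + 1) * Y := by
    rw [mul_comm 901, mul_assoc]
    refine Nat.mul_le_mul_left _ ?_
    have h₄ := Nat.mul_le_mul hN hN
    rw [show 30 * Z ^ 2 * (30 * Z ^ 2) = 900 * Z ^ 4 by ring] at h₄
    have := hY' 4 (by omega)
    omega
  have h₅ : (p.maxConst + C + k + q) * 1 ≤ (p.maxConst + C + k + q) * Y :=
    Nat.mul_le_mul_left _ hY0
  rw [← hZ, ← hY, magnitude, magnitudeFactor]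
  have : (p.maxConst + C + k + q + C * 30 ^ k + 901 * (C + 1) + 100) * Y =
    (p.maxConst + C + k + q) * Y + C * 30 ^ k * Y + 901 * (C + 1) * Y + 100 * Y := by ring
  omega

/-- Rounding down `n / q` loses less than one in the exponent, hence at most a factor `2`. -/
theorem two_pow_sub_div_le {n q : ℕ} (hq : 0 < q) :
    (2 : ℝ) ^ (n - n / q) ≤ 2 * ((2 : ℝ) ^ (1 - 1 / (q : ℝ))) ^ n := by
  have hq' : (0 : ℝ) < q := by exact_mod_cast hq
  rw [← Real.rpow_natCast, ← Real.rpow_natCast, ← Real.rpow_mul zero_le_two,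
    Nat.cast_sub (Nat.div_le_self _ _)]
  calc (2 : ℝ) ^ ((n : ℝ) - (n / q : ℕ))
      ≤ 2 ^ (1 + (1 - 1 / (q : ℝ)) * n) := by
        refine Real.rpow_le_rpow_of_exponent_le one_le_two ?_
        have h : (n : ℝ) / q < (n / q : ℕ) + 1 := by
          rw [div_lt_iff₀ hq']
          have := Nat.lt_div_mul_add hq (a := n)
          have h' : n < (n / q + 1) * q := by rw [add_mul]; omega
          exact_mod_cast h'
        have h' : (1 - 1 / (q : ℝ)) * n = n - n / q := by ring
        rw [h']
        linarith
    _ = _ := by rw [Real.rpow_add two_pos, Real.rpow_one]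

/-- The time limit is large enough for an algorithm with running time `C * N ^ (2 - ε)`. -/
theorem le_timeLimit {C q t : ℕ} {ε : ℝ} (hε : 0 < ε) (hq : 2 / ε ≤ q)
    (ht : (t : ℝ) ≤ C * (φ.hypergraph.totalSize : ℝ) ^ (2 - ε)) : t ≤ timeLimit φ C q := by
  obtain ⟨N, hN⟩ : ∃ N, N = φ.hypergraph.totalSize := ⟨_, rfl⟩
  have hpow := two_pow_le_totalSize_mul_self φ
  rw [← hN] at ht hpow
  have hN0 : 0 < N := by
    rcases N.eq_zero_or_pos with rfl | h
    · simp at hpow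
    · exact h
  have hN' : (0 : ℝ) < N := by exact_mod_cast hN0
  have hq0 : (0 : ℝ) < q := (by positivity : 0 < 2 / ε).trans_le hq
  -- Combines `1 / q ≤ ε / 2` with `2 ^ n ≤ N ^ 2`: dividing `N ^ 2` by this power leaves at least
  -- `N ^ (2 - ε)`.
  have hle : (2 : ℝ) ^ (φ.numVars / q) ≤ (N : ℝ) ^ ε := by
    calc (2 : ℝ) ^ (φ.numVars / q) = (2 : ℝ) ^ ((φ.numVars / q : ℕ) : ℝ) :=
          (Real.rpow_natCast _ _).symm
      _ ≤ 2 ^ ((φ.numVars : ℝ) * (ε / 2)) := by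
          refine Real.rpow_le_rpow_of_exponent_le one_le_two (Nat.cast_div_le.trans ?_)
          rw [div_eq_mul_inv]
          gcongr
          rw [inv_le_comm₀ hq0 (by positivity), inv_div]
          exact hq
      _ = ((2 : ℝ) ^ φ.numVars) ^ (ε / 2) := by
          rw [Real.rpow_mul zero_le_two, Real.rpow_natCast]
      _ ≤ ((N : ℝ) ^ (2 : ℝ)) ^ (ε / 2) := by
          gcongr
          rw [Real.rpow_two, pow_two]
          exact_mod_cast hpow
      _ = (N : ℝ) ^ ε := by
          rw [← Real.rpow_mul hN'.le]
          congr 1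
          ring
  -- The `1` in the time limit makes up for the rounding in the integer division.
  have hdiv : (N : ℝ) ^ (2 - ε) ≤ (N * N / 2 ^ (φ.numVars / q) : ℕ) + 1 := by
    rw [Real.rpow_sub hN', Real.rpow_two]
    calc (N : ℝ) ^ 2 / (N : ℝ) ^ ε ≤ (N : ℝ) ^ 2 / 2 ^ (φ.numVars / q) := by gcongr
      _ ≤ _ := by
        rw [div_le_iff₀ (by positivity)]
        have := Nat.lt_div_mul_add (a := N * N) (b := 2 ^ (φ.numVars / q)) (by positivity)
        have h' : N ^ 2 ≤ (N * N / 2 ^ (φ.numVars / q) + 1) * 2 ^ (φ.numVars / q) := by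
          rw [add_mul, pow_two]
          omega
        exact_mod_cast h'
  rw [timeLimit, ← hN]
  have : (t : ℝ) ≤ C * ((N * N / 2 ^ (φ.numVars / q) : ℕ) + 1) :=
    ht.trans (by gcongr)
  exact_mod_cast this

end RAM

open RAM in
/-- A fast algorithm for union join graphs of a class that contains all acyclic hypertrees would
give a fast algorithm for satisfiability. -/
theorem SETH.not_constructsUnionJoinGraph (hSETH : SETH) {P : FinHypergraph → Prop}
    (hP : ∀ H : FinHypergraph, H.IsAcyclic → H.IsHypertree → P H) {ε : ℝ} (hε : 0 < ε) {K : ℝ}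
    (hK : 1 ≤ K) (p : Prog) : ¬ ConstructsUnionJoinGraph P K ε p := by
  rintro ⟨C, k, h⟩
  obtain ⟨q₀, hq₀⟩ := exists_nat_ge (2 / ε)
  -- The bound `2 / ε ≤ q` makes the clock long enough; `2 ≤ q` keeps the time for writing the
  -- hypergraph within the budget and gives `δ < 1`.
  obtain ⟨q, hq, hq2⟩ : ∃ q : ℕ, 2 / ε ≤ q ∧ 2 ≤ q :=
    ⟨max q₀ 2, hq₀.trans (by exact_mod_cast le_max_left _ _), le_max_right _ _⟩
  have hq' : (1 : ℝ) / q ≤ 1 / 2 := by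
    have : (2 : ℝ) ≤ q := by exact_mod_cast hq2
    gcongr
  have hq0 : (0 : ℝ) < 1 / q := by
    have : (0 : ℝ) < q := by exact_mod_cast (show 0 < q by omega)
    positivity
  refine hSETH ⟨2 - 2 ^ (1 - 1 / (q : ℝ)), .solveSat p C k q, ?_, ?_, ?_⟩
  · have : (2 : ℝ) ^ (1 - 1 / (q : ℝ)) < 2 ^ (1 : ℝ) :=
      Real.rpow_lt_rpow_of_exponent_lt one_lt_two (by linarith)
    rw [Real.rpow_one] at this
    linarith
  · have : (1 : ℝ) < 2 ^ (1 - 1 / (q : ℝ)) := Real.one_lt_rpow one_lt_two (by linarith)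
    linarith
  obtain ⟨G, hG⟩ : ∃ G, G = magnitudeFactor p C k q := ⟨_, rfl⟩
  obtain ⟨F, hF⟩ : ∃ F, F = 1400 + 3 * k + p.simCost * (901 * C + 1) := ⟨_, rfl⟩
  -- `5 * (G * G)` serves the bound on the words and `2 * F` the bound on the time. The exponent is
  -- doubled because the word bound is quadratic in `magnitude`.
  refine ⟨5 * (G * G) + 2 * F, 2 * (2 * k + 4), fun φ => ?_⟩
  obtain ⟨hsound, hhalt⟩ := h φ.hypergraph φ.hypergraph_connected
    (hP _ φ.hypergraph_isAcyclic φ.hypergraph_isHypertree)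
  have hW : 5 * (magnitude φ p C k q * magnitude φ p C k q) ≤
      (5 * (G * G) + 2 * F) * (2 ^ φ.numVars * φ.size) ^ (2 * (2 * k + 4)) := by
    have hm := magnitude_le (φ := φ) (p := p) (C := C) (k := k) (q := q)
    rw [← hG] at hm
    calc 5 * (magnitude φ p C k q * magnitude φ p C k q)
        ≤ 5 * ((G * (2 ^ φ.numVars * φ.size) ^ (2 * k + 4)) *
            (G * (2 ^ φ.numVars * φ.size) ^ (2 * k + 4))) :=
          Nat.mul_le_mul_left _ (Nat.mul_le_mul hm hm)
      _ = 5 * (G * G) * (2 ^ φ.numVars * φ.size) ^ (2 * (2 * k + 4)) := by ring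
      _ ≤ _ := Nat.mul_le_mul_right _ (Nat.le_add_right _ _)
  obtain ⟨t, s, he, ht, hout⟩ := wp_solveSat (q := q) hW hsound fun hsat => by
    -- For an unsatisfiable formula there are `m - 1` edges, which is sparse because `1 ≤ K`.
    obtain ⟨t, s, he, ht⟩ := hhalt (by
      have h₁ := φ.ncard_edgeSet_of_not_satisfiable hsat
      have h₂ : (φ.hypergraph.unionJoinGraph.edgeSet.ncard : ℝ) ≤ φ.hypergraph.m := by
        exact_mod_cast (Nat.le_succ _).trans h₁.le
      exact h₂.trans (le_mul_of_one_le_left (Nat.cast_nonneg _) hK))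
    exact ⟨t, s, he, le_timeLimit hε hq ht⟩
  refine ⟨t, s, he, ?_, hout⟩
  rw [zero_add] at ht
  have hcost := ht.trans (solveCost_le hq2)
  rw [← hF] at hcost
  have hS : (1 : ℝ) ≤ φ.size := by exact_mod_cast (size_spec φ).1
  rw [sub_sub_cancel]
  calc (t : ℝ) ≤ F * ((2 : ℝ) ^ (φ.numVars - φ.numVars / q) * φ.size ^ 3) := by
        exact_mod_cast hcost
    _ ≤ F * ((2 * ((2 : ℝ) ^ (1 - 1 / (q : ℝ))) ^ φ.numVars) *
          φ.size ^ (2 * (2 * k + 4))) := by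
        gcongr
        · exact two_pow_sub_div_le (by omega)
        · omega
    _ = (2 * F : ℝ) * ((2 : ℝ) ^ (1 - 1 / (q : ℝ))) ^ φ.numVars *
          φ.size ^ (2 * (2 * k + 4)) := by ring
    _ ≤ _ := by
        gcongr
        push_cast
        nlinarith [sq_nonneg (G : ℝ)]

theorem mainTheorem1 (hSETH : SETH) (ε : ℝ) (hε : 0 < ε) (K : ℝ) (hK : 1 ≤ K) :
    (¬ ∃ p : RAM.Prog, ConstructsUnionJoinGraph (fun H => H.IsAcyclic) K ε p) ∧
    (¬ ∃ p : RAM.Prog,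
      ConstructsUnionJoinGraph (fun H => H.IsAcyclic ∧ H.IsHypertree) K ε p) := by
  refine ⟨fun ⟨p, hp⟩ => ?_, fun ⟨p, hp⟩ => ?_⟩
  · exact hSETH.not_constructsUnionJoinGraph (fun _ h _ => h) hε hK p hp
  · exact hSETH.not_constructsUnionJoinGraph (fun _ h h' => ⟨h, h'⟩) hε hK p hp
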